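/- Let $X$ be a real Banach space and let $\mathcal U$ be a free ultrafilter on $\mathbb N$. For a free ultrafilter $\mathcal V$ on $\mathbb N$, the ultrapower $X^{\mathcal V}$ is the quotient of $\ell_\infty(X)$ by the subspace of the sequences $(x_n)$ with $\lim_{n,\mathcal V}\|x_n\|=0$, and for $A\subset X$ we let $A^{\mathcal V}\subset X^{\mathcal V}$ be the set of the elements that have a representative in $A^{\mathbb N}$. A set $A\subset X$ is relatively super weakly compact (relatively SWC) if $A^{\mathcal V}$ is relatively weakly compact in $X^{\mathcal V}$ for some free ultrafilter $\mathcal V$ on $\mathbb N$, and $A$ is super weakly compact (SWC) if it is relatively SWC and weakly closed. For a bounded subset $A$ of a Banach space $E$ put $$\gamma(A)=\inf\{\varepsilon>0:\ \overline{A}^{w^*}\subset E+\varepsilon B_{E^{**}}\},$$ the weak$^*$ closure being taken in $E^{**}$, and for bounded $A\subset X$ put $\Gamma(A)=\gamma(A^{\mathcal U})$, computed in $X^{\mathcal U}$. Then $\Gamma\ge 0$, and for all bounded sets $A,B\subset X$: 1. $\Gamma(\overline{A})=\Gamma(A)$, where $\overline A$ is the norm closure of $A$; 2. $\Gamma(A)=0$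 if and only if $A$ is relatively SWC, and also if and only if the weak closure $\overline{A}^{w}$ of $A$ is SWC; 3. $\Gamma(A\cup B)=\max\{\Gamma(A),\Gamma(B)\}$; 4. $\Gamma(\lambda A)=|\lambda|\,\Gamma(A)$ for all $\lambda\in\mathbb R$; 5. $\Gamma(A+B)\le\Gamma(A)+\Gamma(B)$; 6. $\Gamma(\operatorname{conv}(A))\le 4\,\Gamma(A)$. -/

import Mathlib

open Filter Topology Set
open scoped ENNReal Pointwise

noncomputable section

namespace SuperWeak

section WeakNoncompactness

variable {E : Type*} [NormedAddCommGroup E] [NormedSpace ℝ E]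

/-- The closure of `A` in the weak topology `σ(E, E*)`. -/
def weakClosure (A : Set E) : Set E :=
  toWeakSpace ℝ E ⁻¹' closure (toWeakSpace ℝ E '' A)

/-- `A` is closed in the weak topology. -/
def IsWeaklyClosed (A : Set E) : Prop :=
  IsClosed (toWeakSpace ℝ E '' A)

/-- `A` is relatively weakly compact: its weak closure in `E` is weakly compact. -/
def IsRelWeaklyCompact (A : Set E) : Prop :=
  IsCompact (closure (toWeakSpace ℝ E '' A))

/-- The closure of (the canonical image of) `A` in the bidual `E**` with respect to the
weak-star topology `σ(E**, E*)`. -/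
def bidualWeakStarClosure (A : Set E) : Set (StrongDual ℝ (StrongDual ℝ E)) :=
  StrongDual.toWeakDual ⁻¹'
    closure (StrongDual.toWeakDual '' (NormedSpace.inclusionInDoubleDual ℝ E '' A))

/-- The measure of weak noncompactness `γ(A)`: the infimum of the `ε > 0` such that the
weak-star closure of `A` in the bidual is contained in `E + ε B_{E**}`. -/
def gammaMeasure (A : Set E) : ℝ :=
  sInf {ε : ℝ | 0 < ε ∧
    bidualWeakStarClosure A ⊆
      Set.range (NormedSpace.inclusionInDoubleDual ℝ E) + ε • Metric.closedBall 0 1}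

end WeakNoncompactness

section Ultrapowers

/-- An ultrafilter on `ℕ` is free when it contains all cofinite sets. -/
def IsFree (U : Ultrafilter ℕ) : Prop :=
  (U : Filter ℕ) ≤ cofinite

variable (U : Ultrafilter ℕ) (X : Type*) [NormedAddCommGroup X] [NormedSpace ℝ X]

/-- The subspace of `ℓ_∞(X)` of the bounded sequences with `lim_U ‖x n‖ = 0`. -/
def nullSequences : Submodule ℝ (lp (fun _ : ℕ => X) ∞) where
  carrier := {x | Tendsto (fun n => ‖x n‖) (U : Filter ℕ) (𝓝 0)}
  zero_mem' := by simp
  add_mem' := by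
    intro x y hx hy
    have h := Tendsto.add hx hy
    rw [add_zero] at h
    exact squeeze_zero (fun n => norm_nonneg _) (fun n => norm_add_le (x n) (y n)) h
  smul_mem' := by
    intro c x hx
    have h := Tendsto.const_mul ‖c‖ hx
    rw [mul_zero] at h
    refine squeeze_zero (fun n => norm_nonneg _) (fun n => ?_) h
    exact (norm_smul c (x n)).le

instance isClosed_nullSequences :
    IsClosed (nullSequences U X : Set (lp (fun _ : ℕ => X) ∞)) := by
  refine isClosed_of_closure_subset fun x hx => ?_
  change Tendsto (fun n => ‖x n‖) (U : Filter ℕ) (𝓝 0)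
  rw [Metric.tendsto_nhds]
  intro ε hε
  obtain ⟨y, hy, hxy⟩ := Metric.mem_closure_iff.1 hx (ε / 2) (half_pos hε)
  have hy' : Tendsto (fun n => ‖y n‖) (U : Filter ℕ) (𝓝 0) := hy
  filter_upwards [Metric.tendsto_nhds.1 hy' (ε / 2) (half_pos hε)] with n hn
  have h1 : ‖x n - y n‖ ≤ ‖x - y‖ := lp.norm_apply_le_norm (by simp) (x - y) n
  have h2 : ‖x n‖ ≤ ‖x n - y n‖ + ‖y n‖ := by
    simpa using norm_add_le (x n - y n) (y n)
  rw [dist_eq_norm] at hxy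
  simp only [Real.dist_eq, sub_zero, abs_norm] at hn ⊢
  linarith

/-- The ultrapower `X^U`, the quotient of `ℓ_∞(X)` by the null sequences along `U`,
with the quotient norm. -/
abbrev Ultrapower : Type _ :=
  lp (fun _ : ℕ => X) ∞ ⧸ nullSequences U X

variable {X}

/-- The subset `A^U` of `X^U`, of the elements that have a representative in `A^ℕ`. -/
def setUltrapower (A : Set X) : Set (Ultrapower U X) :=
  {ξ | ∃ x : lp (fun _ : ℕ => X) ∞, (∀ n, x n ∈ A) ∧ (nullSequences U X).mkQ x = ξ}

/-- The measure of super weak noncompactness `Γ(A) = γ(A^U)`, computed in `X^U`. -/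
def Gam (A : Set X) : ℝ :=
  gammaMeasure (setUltrapower U A)

/-- `A` is relatively super weakly compact: `A^V` is relatively weakly compact in `X^V` for
some free ultrafilter `V`. -/
def IsRelSWC (A : Set X) : Prop :=
  ∃ V : Ultrafilter ℕ, IsFree V ∧ IsRelWeaklyCompact (setUltrapower V A)

/-- `A` is super weakly compact: relatively super weakly compact and weakly closed. -/
def IsSWC (A : Set X) : Prop :=
  IsRelSWC A ∧ IsWeaklyClosed A

end Ultrapowers

end SuperWeak

end

/-! The rules for closures, unions, multiples and sums hold because `setUltrapower` respects these
operations (for sums, one inclusion), while `gammaMeasure` obeys the last three on bounded sets by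
weak-star compactness.

The rest rests on a finite, James-type criterion on X itself, `HasSeparatedSequences`. If `t < Gam U
A` with `t > 0`, then A has separated sequences with every constant below t
(`hasSeparatedSequences_of_lt_Gam`). Conversely, separation by β forces `β ≤ 2 * Gam V A` for every
free V (`HasSeparatedSequences.le_two_mul_Gam`). The criterion mentions no ultrafilter, so vanishing
of Γ does not depend on the free ultrafilter.

For convex hulls, separation passes from `convexHull ℝ A` to A at an arbitrarily small loss
(`HasSeparatedSequences.of_convexHull`). Points of the hull become probability measures on a cube
whose coordinates are the functionals, and an ultralimit makes the finite sequences infinite. Convex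
blocks of the coordinates converge almost everywhere to a function F whose integral drops by β.
Hence F drops by almost β near some point (`exists_forall_dist_lt_drop`), and points chosen there
recover a separated sequence. This gives the constant 2, which also handles weak closures, since
they lie in the closed convex hull. -/

namespace SuperWeak

/-! ### Weak-star hulls and the calculus of γ in a normed space. -/

section GammaMeasure

variable {E : Type*} [NormedAddCommGroup E] [NormedSpace ℝ E]

/-- The weak-star compact set in the bidual underlying `bidualWeakStarClosure`. -/
def weakStarHull (S : Set E) : Set (WeakDual ℝ (StrongDual ℝ E)) :=
  closure (StrongDual.toWeakDual '' (NormedSpace.inclusionInDoubleDual ℝ E '' S))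

lemma weakStarHull_eq_image (S : Set E) :
    weakStarHull S =
      closure (NormedSpace.inclusionInDoubleDualWeak ℝ E '' (toWeakSpace ℝ E '' S)) := by
  rw [weakStarHull, Set.image_image, Set.image_image]
  rfl

lemma isBounded_weakStarHull {S : Set E} (hS : Bornology.IsBounded S) :
    Bornology.IsBounded (weakStarHull S) := by
  obtain ⟨R, hR⟩ := hS.exists_norm_le
  refine (WeakDual.isBounded_closedBall 0 R).subset
    (closure_minimal ?_ (WeakDual.isClosed_closedBall 0 R))
  rintro _ ⟨_, ⟨a, ha, rfl⟩, rfl⟩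
  have h : ‖NormedSpace.inclusionInDoubleDual ℝ E a‖ ≤ R :=
    (NormedSpace.double_dual_bound ℝ E a).trans (hR a ha)
  exact mem_closedBall_zero_iff.2 h

lemma isCompact_weakStarHull {S : Set E} (hS : Bornology.IsBounded S) :
    IsCompact (weakStarHull S) :=
  WeakDual.isCompact_of_bounded_of_closed (isBounded_weakStarHull hS) isClosed_closure

/-- The functional `z` on the dual is within `t` of the evaluation at `e`, in the dual norm. -/
def IsNear (z : StrongDual ℝ (StrongDual ℝ E)) (e : E) (t : ℝ) : Prop :=
  ∀ f : StrongDual ℝ E, |z f - f e| ≤ t * ‖f‖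

lemma IsNear.mono {z : StrongDual ℝ (StrongDual ℝ E)} {e : E} {s t : ℝ} (h : IsNear z e s)
    (hst : s ≤ t) : IsNear z e t :=
  fun f => (h f).trans (mul_le_mul_of_nonneg_right hst (norm_nonneg f))

lemma isNear_iff {z : StrongDual ℝ (StrongDual ℝ E)} {e : E} {t : ℝ} (ht : 0 ≤ t) :
    IsNear z e t ↔ ‖z - NormedSpace.inclusionInDoubleDual ℝ E e‖ ≤ t := by
  constructor
  · intro h
    exact ContinuousLinearMap.opNorm_le_bound _ ht h
  · intro h f
    exact ContinuousLinearMap.le_of_opNorm_le _ h f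

lemma mem_range_add_smul_closedBall {z : StrongDual ℝ (StrongDual ℝ E)} {ε : ℝ} (hε : 0 < ε) :
    z ∈ Set.range (NormedSpace.inclusionInDoubleDual ℝ E) + ε • Metric.closedBall 0 1 ↔
      ∃ e : E, IsNear z e ε := by
  constructor
  · rintro ⟨_, ⟨e, rfl⟩, _, ⟨r, hr, rfl⟩, rfl⟩
    refine ⟨e, fun f => ?_⟩
    have h1 : |r f| ≤ 1 * ‖f‖ :=
      ContinuousLinearMap.le_of_opNorm_le r (mem_closedBall_zero_iff.1 hr) f
    change |f e + ε * r f - f e| ≤ _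
    rw [add_sub_cancel_left, abs_mul, abs_of_pos hε]
    nlinarith
  · rintro ⟨e, he⟩
    refine ⟨_, ⟨e, rfl⟩, _, ⟨ε⁻¹ • (z - NormedSpace.inclusionInDoubleDual ℝ E e), ?_, rfl⟩, ?_⟩
    · have h : ‖ε⁻¹ • (z - NormedSpace.inclusionInDoubleDual ℝ E e)‖ ≤ 1 := by
        refine ContinuousLinearMap.opNorm_le_bound _ zero_le_one fun f => ?_
        change |ε⁻¹ * (z f - f e)| ≤ _
        rw [abs_mul, abs_of_pos (inv_pos.2 hε), one_mul, inv_mul_le_iff₀ hε]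
        exact he f
      exact (mem_closedBall_zero_iff (E := StrongDual ℝ (StrongDual ℝ E))).2 h
    · refine ContinuousLinearMap.ext fun f => ?_
      change f e + ε * (ε⁻¹ * (z f - f e)) = z f
      rw [mul_inv_cancel_left₀ hε.ne']
      ring

lemma gammaMeasure_nonneg (S : Set E) : 0 ≤ gammaMeasure S :=
  Real.sInf_nonneg fun _ h => h.1.le

lemma gammaMeasure_le {S : Set E} {t : ℝ} (ht : 0 < t)
    (h : ∀ z ∈ bidualWeakStarClosure S, ∃ e : E, IsNear z e t) : gammaMeasure S ≤ t :=
  csInf_le ⟨0, fun _ h => h.1.le⟩ ⟨ht, fun z hz => (mem_range_add_smul_closedBall ht).2 (h z hz)⟩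

lemma exists_isNear_of_gammaMeasure_lt {S : Set E} (hS : Bornology.IsBounded S) {t : ℝ}
    (ht : gammaMeasure S < t) {z : StrongDual ℝ (StrongDual ℝ E)}
    (hz : z ∈ bidualWeakStarClosure S) : ∃ e : E, IsNear z e t := by
  obtain ⟨R, hR0, hR⟩ :=
    (WeakDual.isBounded_toStrongDual_preimage_iff_isBounded.2
      (isBounded_weakStarHull hS)).exists_pos_norm_le
  -- Boundedness supplies an admissible radius, with 0 as the near point; otherwise the infimum
  -- could be the default value of `sInf ∅`.
  have hne : {ε : ℝ | 0 < ε ∧ bidualWeakStarClosure S ⊆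
      Set.range (NormedSpace.inclusionInDoubleDual ℝ E) + ε • Metric.closedBall 0 1}.Nonempty := by
    refine ⟨R, hR0, fun w hw => (mem_range_add_smul_closedBall hR0).2 ⟨0, fun f => ?_⟩⟩
    rw [map_zero, sub_zero]
    exact ContinuousLinearMap.le_of_opNorm_le w (hR w hw) f
  obtain ⟨δ, ⟨hδ, hsub⟩, hδt⟩ := exists_lt_of_csInf_lt hne ht
  obtain ⟨e, he⟩ := (mem_range_add_smul_closedBall hδ).1 (hsub hz)
  exact ⟨e, he.mono hδt.le⟩

lemma exists_not_isNear_of_lt_gammaMeasure {S : Set E} {t : ℝ} (ht : 0 < t)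
    (h : t < gammaMeasure S) : ∃ z ∈ bidualWeakStarClosure S, ∀ e : E, ¬ IsNear z e t := by
  by_contra! hc
  exact h.not_ge (gammaMeasure_le ht hc)

lemma gammaMeasure_le_of_forall {S : Set E} {t : ℝ} (ht : 0 ≤ t)
    (h : ∀ s > t, ∀ z ∈ bidualWeakStarClosure S, ∃ e : E, IsNear z e s) : gammaMeasure S ≤ t :=
  le_of_forall_gt_imp_ge_of_dense fun s hs => gammaMeasure_le (ht.trans_lt hs) (h s hs)

lemma bidualWeakStarClosure_mono {S T : Set E} (h : S ⊆ T) :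
    bidualWeakStarClosure S ⊆ bidualWeakStarClosure T :=
  Set.preimage_mono (closure_mono (Set.image_mono (Set.image_mono h)))

lemma gammaMeasure_mono {S T : Set E} (hT : Bornology.IsBounded T) (h : S ⊆ T) :
    gammaMeasure S ≤ gammaMeasure T :=
  gammaMeasure_le_of_forall (gammaMeasure_nonneg T) fun _ hs _ hz =>
    exists_isNear_of_gammaMeasure_lt hT hs (bidualWeakStarClosure_mono h hz)

lemma gammaMeasure_union {S T : Set E} (hS : Bornology.IsBounded S) (hT : Bornology.IsBounded T) :
    gammaMeasure (S ∪ T) = max (gammaMeasure S) (gammaMeasure T) := by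
  refine le_antisymm (gammaMeasure_le_of_forall (le_max_of_le_left (gammaMeasure_nonneg S)) ?_)
    (max_le (gammaMeasure_mono (hS.union hT) subset_union_left)
      (gammaMeasure_mono (hS.union hT) subset_union_right))
  intro s hs z hz
  rw [bidualWeakStarClosure, Set.image_union, Set.image_union, closure_union] at hz
  rcases hz with hz | hz
  · exact exists_isNear_of_gammaMeasure_lt hS ((le_max_left _ _).trans_lt hs) hz
  · exact exists_isNear_of_gammaMeasure_lt hT ((le_max_right _ _).trans_lt hs) hz

/-- A sum of two weak-star compact sets is compact, hence closed, so it absorbs the closure. -/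
lemma weakStarHull_add_subset {S T : Set E} (hS : Bornology.IsBounded S)
    (hT : Bornology.IsBounded T) : weakStarHull (S + T) ⊆ weakStarHull S + weakStarHull T := by
  refine closure_minimal ?_ ((isCompact_weakStarHull hS).add (isCompact_weakStarHull hT)).isClosed
  rintro _ ⟨_, ⟨_, ⟨a, ha, b, hb, rfl⟩, rfl⟩, rfl⟩
  refine ⟨_, subset_closure ⟨_, ⟨a, ha, rfl⟩, rfl⟩, _, subset_closure ⟨_, ⟨b, hb, rfl⟩, rfl⟩, ?_⟩
  exact DFunLike.ext _ _ fun f => (map_add f a b).symm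

lemma gammaMeasure_add_le {S T : Set E} (hS : Bornology.IsBounded S)
    (hT : Bornology.IsBounded T) :
    gammaMeasure (S + T) ≤ gammaMeasure S + gammaMeasure T := by
  refine gammaMeasure_le_of_forall (add_nonneg (gammaMeasure_nonneg S) (gammaMeasure_nonneg T)) ?_
  intro s hs z hz
  obtain ⟨u, hu, v, hv, huv⟩ := weakStarHull_add_subset hS hT hz
  obtain ⟨e, he⟩ := exists_isNear_of_gammaMeasure_lt hS
    (t := gammaMeasure S + (s - (gammaMeasure S + gammaMeasure T)) / 2) (by linarith)
    (z := WeakDual.toStrongDual u) hu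
  obtain ⟨e', he'⟩ := exists_isNear_of_gammaMeasure_lt hT
    (t := gammaMeasure T + (s - (gammaMeasure S + gammaMeasure T)) / 2) (by linarith)
    (z := WeakDual.toStrongDual v) hv
  refine ⟨e + e', fun f => ?_⟩
  have hz' : z f = WeakDual.toStrongDual u f + WeakDual.toStrongDual v f :=
    (DFunLike.congr_fun huv f).symm
  rw [hz', map_add, add_sub_add_comm]
  refine (abs_add_le _ _).trans ((add_le_add (he f) (he' f)).trans (le_of_eq ?_))
  ring

lemma weakStarHull_smul_subset {S : Set E} (hS : Bornology.IsBounded S) (c : ℝ) :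
    weakStarHull (c • S) ⊆ c • weakStarHull S := by
  refine closure_minimal ?_ ((isCompact_weakStarHull hS).smul c).isClosed
  rintro _ ⟨_, ⟨_, ⟨a, ha, rfl⟩, rfl⟩, rfl⟩
  refine ⟨_, subset_closure ⟨_, ⟨a, ha, rfl⟩, rfl⟩, ?_⟩
  exact DFunLike.ext _ _ fun f => (map_smul f c a).symm

lemma gammaMeasure_smul_le {S : Set E} (hS : Bornology.IsBounded S) (c : ℝ) :
    gammaMeasure (c • S) ≤ |c| * gammaMeasure S := by
  refine gammaMeasure_le_of_forall (mul_nonneg (abs_nonneg c) (gammaMeasure_nonneg S)) ?_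
  intro s hs z hz
  obtain ⟨u, hu, huz⟩ := weakStarHull_smul_subset hS c hz
  -- Dividing by `|c| + 1` instead of `|c|` covers `c = 0`.
  set δ := (s - |c| * gammaMeasure S) / (|c| + 1) with hδ
  have hc1 : 0 < |c| + 1 := by positivity
  have hδ0 : 0 < δ := div_pos (by linarith) hc1
  obtain ⟨e, he⟩ := exists_isNear_of_gammaMeasure_lt hS
    (t := gammaMeasure S + δ) (by linarith) (z := WeakDual.toStrongDual u) hu
  refine ⟨c • e, fun f => ?_⟩
  have hz' : z f = c * WeakDual.toStrongDual u f := (DFunLike.congr_fun huz f).symm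
  rw [hz', map_smul, smul_eq_mul, ← mul_sub, abs_mul]
  have h1 : δ * (|c| + 1) = s - |c| * gammaMeasure S := div_mul_cancel₀ _ hc1.ne'
  calc |c| * _ ≤ |c| * ((gammaMeasure S + δ) * ‖f‖) :=
        mul_le_mul_of_nonneg_left (he f) (abs_nonneg c)
    _ = |c| * (gammaMeasure S + δ) * ‖f‖ := by ring
    _ ≤ s * ‖f‖ := mul_le_mul_of_nonneg_right (by nlinarith) (norm_nonneg f)

lemma gammaMeasure_smul {S : Set E} (hS : Bornology.IsBounded S) (c : ℝ) :
    gammaMeasure (c • S) = |c| * gammaMeasure S := by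
  refine le_antisymm (gammaMeasure_smul_le hS c) ?_
  rcases eq_or_ne c 0 with rfl | hc
  · simpa using gammaMeasure_nonneg _
  · have h := gammaMeasure_smul_le (hS.smul₀ c) c⁻¹
    rw [inv_smul_smul₀ hc, abs_inv] at h
    rwa [← le_inv_mul_iff₀ (abs_pos.2 hc)]

/-- A functional on the dual that is arbitrarily near to points of a Banach space is one of
them. -/
lemma exists_eq_of_forall_isNear [CompleteSpace E] {z : StrongDual ℝ (StrongDual ℝ E)}
    (h : ∀ t > 0, ∃ e : E, IsNear z e t) :
    ∃ e : E, NormedSpace.inclusionInDoubleDual ℝ E e = z := by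
  have hcl :=
    (NormedSpace.inclusionInDoubleDualLi
      (E := E) ℝ).isometry.isUniformInducing.isComplete_range.isClosed
  have hmem : z ∈ closure (Set.range (NormedSpace.inclusionInDoubleDualLi (E := E) ℝ)) := by
    refine (Metric.mem_closure_iff (α := StrongDual ℝ (StrongDual ℝ E))).2 fun ε hε => ?_
    obtain ⟨e, he⟩ := h (ε / 2) (by positivity)
    refine ⟨_, ⟨e, rfl⟩, ?_⟩
    refine (dist_eq_norm (E := StrongDual ℝ (StrongDual ℝ E)) _ _).trans_lt ?_
    exact ((isNear_iff (by positivity)).1 he).trans_lt (half_lt_self hε)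
  exact hcl.closure_subset hmem

/-- If γ vanishes, the hull lies in the norm closure of E, which is E by completeness. Conversely, a
weakly compact closure has a weak-star closed image, so the hull does not leave E. -/
lemma gammaMeasure_eq_zero_iff [CompleteSpace E] {S : Set E} (hS : Bornology.IsBounded S) :
    gammaMeasure S = 0 ↔ IsRelWeaklyCompact S := by
  constructor
  · intro h
    refine NormedSpace.isCompact_closure_of_isBounded ℝ E _ ?_ ?_
    · rwa [Set.preimage_image_eq _ (toWeakSpace ℝ E).injective]
    · intro z hz
      rw [← weakStarHull_eq_image] at hz
      obtain ⟨e, he⟩ := exists_eq_of_forall_isNear (z := WeakDual.toStrongDual z) fun t ht =>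
        exists_isNear_of_gammaMeasure_lt hS (by rwa [h]) hz
      exact ⟨toWeakSpace ℝ E e, congrArg StrongDual.toWeakDual he⟩
  · intro h
    refine le_antisymm (gammaMeasure_le_of_forall le_rfl fun s hs z hz => ?_)
      (gammaMeasure_nonneg S)
    have hcl : weakStarHull S ⊆ NormedSpace.inclusionInDoubleDualWeak ℝ E ''
        closure (toWeakSpace ℝ E '' S) := by
      rw [weakStarHull_eq_image]
      refine closure_minimal (Set.image_mono subset_closure) ?_
      exact (h.image (NormedSpace.inclusionInDoubleDualWeak ℝ E).continuous).isClosed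
    obtain ⟨e, -, he⟩ := hcl hz
    refine ⟨(toWeakSpace ℝ E).symm e, fun f => ?_⟩
    have : f ((toWeakSpace ℝ E).symm e) = z f := DFunLike.congr_fun he f
    rw [this, sub_self, abs_zero]
    exact mul_nonneg (le_of_lt hs) (norm_nonneg f)

end GammaMeasure

/-! ### Ultralimits of functionals and norms in the ultrapower. -/

section UltralimitFunctionals

variable (U : Ultrafilter ℕ)

lemma exists_ultralimit_functional {E : Type*} [NormedAddCommGroup E] [NormedSpace ℝ E]
    {g : ℕ → StrongDual ℝ E} {C : ℝ} (hg : ∀ n, ‖g n‖ ≤ C) :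
    ∃ f : StrongDual ℝ E, ‖f‖ ≤ C ∧
      ∀ e, Tendsto (fun n => g n e) (U : Filter ℕ) (𝓝 (f e)) := by
  have hK := WeakDual.isCompact_closedBall (𝕜 := ℝ) (E := E) 0 C
  have hmem : ∀ n, StrongDual.toWeakDual (g n) ∈
      WeakDual.toStrongDual ⁻¹' Metric.closedBall (0 : StrongDual ℝ E) C :=
    fun n => mem_closedBall_zero_iff.2 (hg n)
  obtain ⟨w, hw, hlim⟩ := hK.ultrafilter_le_nhds' (U.map fun n => StrongDual.toWeakDual (g n))
    (Ultrafilter.mem_map.2 (Filter.univ_mem' hmem))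
  refine ⟨WeakDual.toStrongDual w, mem_closedBall_zero_iff.1 hw, fun e => ?_⟩
  have h : Tendsto (fun n => StrongDual.toWeakDual (g n)) (U : Filter ℕ) (𝓝 w) := hlim
  exact ((WeakDual.eval_continuous e).tendsto w).comp h

variable {X : Type*} [NormedAddCommGroup X]

lemma exists_lp_of_norm_le {s : ℕ → X} {C : ℝ} (hs : ∀ n, ‖s n‖ ≤ C) :
    ∃ x : lp (fun _ : ℕ => X) ∞, ∀ n, x n = s n :=
  ⟨⟨s, memℓp_infty ⟨C, by rintro _ ⟨n, rfl⟩; exact hs n⟩⟩, fun _ => rfl⟩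

lemma norm_apply_le_norm_of_lp (x : lp (fun _ : ℕ => X) ∞) : ∀ n, ‖x n‖ ≤ ‖x‖ :=
  fun n => lp.norm_apply_le_norm (by simp) x n

variable [NormedSpace ℝ X]

lemma mkQ_eq_mkQ_iff {x y : lp (fun _ : ℕ => X) ∞} :
    (nullSequences U X).mkQ x = (nullSequences U X).mkQ y ↔
      Tendsto (fun n => ‖x n - y n‖) (U : Filter ℕ) (𝓝 0) :=
  Submodule.Quotient.eq _

lemma mkQ_eq_of_eventuallyEq {x y : lp (fun _ : ℕ => X) ∞}
    (h : ∀ᶠ n in (U : Filter ℕ), x n = y n) :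
    (nullSequences U X).mkQ x = (nullSequences U X).mkQ y := by
  rw [mkQ_eq_mkQ_iff]
  refine tendsto_const_nhds.congr' ?_
  filter_upwards [h] with n hn
  rw [hn, sub_self, norm_zero]

lemma norm_mkQ_le_of_eventually {x : lp (fun _ : ℕ => X) ∞} {c : ℝ} (hc : 0 ≤ c)
    (h : ∀ᶠ n in (U : Filter ℕ), ‖x n‖ ≤ c) : ‖(nullSequences U X).mkQ x‖ ≤ c := by
  classical
  have hb : ∀ n, ‖(if ‖x n‖ ≤ c then x n else 0)‖ ≤ c := fun n => by
    split_ifs with hn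
    · exact hn
    · simpa using hc
  obtain ⟨y, hy⟩ := exists_lp_of_norm_le hb
  have hxy : (nullSequences U X).mkQ x = (nullSequences U X).mkQ y := by
    refine mkQ_eq_of_eventuallyEq U ?_
    filter_upwards [h] with n hn
    rw [hy, if_pos hn]
  rw [hxy]
  refine (Submodule.Quotient.norm_mk_le _ y).trans (lp.norm_le_of_forall_le hc fun n => ?_)
  rw [hy]
  exact hb n

lemma exists_ultraproduct_functional {g : ℕ → StrongDual ℝ X} {C : ℝ} (hg : ∀ n, ‖g n‖ ≤ C) :
    ∃ f : StrongDual ℝ (Ultrapower U X), ‖f‖ ≤ C ∧ ∀ x : lp (fun _ : ℕ => X) ∞,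
      Tendsto (fun n => g n (x n)) (U : Filter ℕ) (𝓝 (f ((nullSequences U X).mkQ x))) := by
  have hC : 0 ≤ C := (norm_nonneg _).trans (hg 0)
  have hbd : ∀ (n : ℕ) (x : lp (fun _ : ℕ => X) ∞), ‖g n (x n)‖ ≤ C * ‖x n‖ := fun n x =>
    (g n).le_of_opNorm_le (hg n) (x n)
  let ev : ℕ → StrongDual ℝ (lp (fun _ : ℕ => X) ∞) := fun n =>
    LinearMap.mkContinuous
      { toFun := fun x => g n (x n)
        map_add' := fun x y => map_add (g n) (x n) (y n)
        map_smul' := fun c x => map_smul (g n) c (x n) } C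
      fun x => (hbd n x).trans (mul_le_mul_of_nonneg_left (norm_apply_le_norm_of_lp x n) hC)
  have hev : ∀ n, ‖ev n‖ ≤ C := fun n => LinearMap.mkContinuous_norm_le _ hC _
  obtain ⟨F, hF, hlim⟩ := exists_ultralimit_functional U hev
  have hlim' : ∀ x : lp (fun _ : ℕ => X) ∞,
      Tendsto (fun n => g n (x n)) (U : Filter ℕ) (𝓝 (F x)) := hlim
  -- The ultralimit on ℓ_∞(X) kills null sequences, so it descends to the quotient; near-optimal
  -- representatives keep the bound C.
  have hker : nullSequences U X ≤ LinearMap.ker (F : lp (fun _ : ℕ => X) ∞ →ₗ[ℝ] ℝ) := by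
    intro x hx
    have h0 : Tendsto (fun n => g n (x n)) (U : Filter ℕ) (𝓝 0) := by
      have hx' : Tendsto (fun n => C * ‖x n‖) (U : Filter ℕ) (𝓝 0) := by
        have := Tendsto.const_mul C (show Tendsto (fun n => ‖x n‖) (U : Filter ℕ) (𝓝 0) from hx)
        rwa [mul_zero] at this
      exact squeeze_zero_norm (fun n => hbd n x) hx'
    exact tendsto_nhds_unique (hlim' x) h0
  refine ⟨LinearMap.mkContinuous ((nullSequences U X).liftQ _ hker) C fun ξ => ?_,
    LinearMap.mkContinuous_norm_le _ hC _, fun x => hlim' x⟩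
  refine le_of_forall_pos_le_add fun ε hε => ?_
  obtain ⟨x, rfl, hx⟩ := Submodule.Quotient.norm_mk_lt ξ (ε := ε / (C + 1)) (by positivity)
  have h1 : ‖F x‖ ≤ C * ‖x‖ := F.le_of_opNorm_le hF x
  have h2 : ε / (C + 1) * (C + 1) = ε := div_mul_cancel₀ _ (by positivity)
  have h3 : 0 < ε / (C + 1) := by positivity
  calc ‖F x‖ ≤ C * ‖x‖ := h1
    _ ≤ C * (‖(Submodule.Quotient.mk x : Ultrapower U X)‖ + ε / (C + 1)) :=
        mul_le_mul_of_nonneg_left hx.le hC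
    _ ≤ _ := by nlinarith

end UltralimitFunctionals

/-! ### Ultrapowers of sets and set operations. -/

section SetUltrapower

variable (U : Ultrafilter ℕ) {X : Type*} [NormedAddCommGroup X] [NormedSpace ℝ X]

lemma isBounded_setUltrapower {A : Set X} (hA : Bornology.IsBounded A) :
    Bornology.IsBounded (setUltrapower U A) := by
  obtain ⟨R, hR0, hR⟩ := hA.exists_pos_norm_le
  refine isBounded_iff_forall_norm_le.2 ⟨R, ?_⟩
  rintro _ ⟨x, hx, rfl⟩
  exact norm_mkQ_le_of_eventually U hR0.le (Eventually.of_forall fun n => hR _ (hx n))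

lemma setUltrapower_mono {A B : Set X} (h : A ⊆ B) : setUltrapower U A ⊆ setUltrapower U B := by
  rintro _ ⟨x, hx, rfl⟩
  exact ⟨x, fun n => h (hx n), rfl⟩

/-- Approximating the n-th coordinate within `1 / (n + 1)` changes a representative by a null
sequence; this is where freeness enters. -/
lemma setUltrapower_closure (hU : IsFree U) (A : Set X) :
    setUltrapower U (closure A) = setUltrapower U A := by
  refine Subset.antisymm ?_ (setUltrapower_mono U subset_closure)
  rintro _ ⟨x, hx, rfl⟩
  have : ∀ n : ℕ, ∃ a ∈ A, dist (x n) a < 1 / ((n : ℝ) + 1) := fun n =>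
    Metric.mem_closure_iff.1 (hx n) _ (by positivity)
  choose a ha hxa using this
  have hna : ∀ n, ‖a n‖ ≤ ‖x‖ + 1 := fun n => by
    have h1 : ‖a n‖ ≤ ‖x n‖ + ‖x n - a n‖ := by
      simpa using norm_sub_le (x n) (x n - a n)
    have h2 : (1 : ℝ) / (n + 1) ≤ 1 := by
      rw [div_le_one (by positivity)]
      linarith [(Nat.cast_nonneg n : (0 : ℝ) ≤ n)]
    have h3 := hxa n
    rw [dist_eq_norm] at h3
    linarith [norm_apply_le_norm_of_lp x n]
  obtain ⟨y, hy⟩ := exists_lp_of_norm_le hna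
  refine ⟨y, fun n => by rw [hy]; exact ha n, (mkQ_eq_mkQ_iff U).2 ?_⟩
  have h0 : Tendsto (fun n : ℕ => 1 / ((n : ℝ) + 1)) (U : Filter ℕ) (𝓝 0) :=
    tendsto_one_div_add_atTop_nhds_zero_nat.mono_left (by rw [← Nat.cofinite_eq_atTop]; exact hU)
  refine squeeze_zero (fun n => norm_nonneg _) (fun n => ?_) h0
  rw [hy, ← dist_eq_norm, dist_comm]
  exact (hxa n).le

lemma setUltrapower_union (A B : Set X) :
    setUltrapower U (A ∪ B) = setUltrapower U A ∪ setUltrapower U B := by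
  classical
  have key : ∀ (C : Set X) (x : lp (fun _ : ℕ => X) ∞), (∀ᶠ n in (U : Filter ℕ), x n ∈ C) →
      (nullSequences U X).mkQ x ∈ setUltrapower U C := by
    intro C x hx
    obtain ⟨m, hm⟩ := hx.exists
    -- Coordinates outside C are overwritten by one coordinate lying in C, so the new representative
    -- is bounded and in C everywhere.
    have hb : ∀ n, ‖(if x n ∈ C then x n else x m)‖ ≤ ‖x‖ := fun n => by
      split_ifs <;> exact norm_apply_le_norm_of_lp x _
    obtain ⟨y, hy⟩ := exists_lp_of_norm_le hb
    refine ⟨y, fun n => ?_, mkQ_eq_of_eventuallyEq U ?_⟩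
    · rw [hy]
      split_ifs with h
      exacts [h, hm]
    · filter_upwards [hx] with n hn
      rw [hy, if_pos hn]
  refine Subset.antisymm ?_ (union_subset (setUltrapower_mono U subset_union_left)
    (setUltrapower_mono U subset_union_right))
  rintro _ ⟨x, hx, rfl⟩
  rcases Ultrafilter.eventually_or.1
    (Eventually.of_forall hx : ∀ᶠ n in (U : Filter ℕ), _) with h | h
  · exact Or.inl (key A x h)
  · exact Or.inr (key B x h)

lemma setUltrapower_smul {A : Set X} (hA : Bornology.IsBounded A) (c : ℝ) :
    setUltrapower U (c • A) = c • setUltrapower U A := by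
  obtain ⟨R, hR⟩ := hA.exists_norm_le
  ext ξ
  constructor
  · rintro ⟨x, hx, rfl⟩
    choose a ha hxa using hx
    obtain ⟨y, hy⟩ := exists_lp_of_norm_le fun n => hR _ (ha n)
    refine ⟨_, ⟨y, fun n => by rw [hy]; exact ha n, rfl⟩, ?_⟩
    change c • (nullSequences U X).mkQ y = _
    rw [← map_smul]
    congr 1
    ext n
    rw [← hxa n]
    change c • y n = c • a n
    rw [hy]
  · rintro ⟨_, ⟨x, hx, rfl⟩, rfl⟩
    exact ⟨c • x, fun n => ⟨x n, hx n, rfl⟩, map_smul _ _ _⟩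

lemma setUltrapower_add_subset {A B : Set X} (hA : Bornology.IsBounded A)
    (hB : Bornology.IsBounded B) :
    setUltrapower U (A + B) ⊆ setUltrapower U A + setUltrapower U B := by
  obtain ⟨R, hR⟩ := hA.exists_norm_le
  obtain ⟨R', hR'⟩ := hB.exists_norm_le
  rintro _ ⟨x, hx, rfl⟩
  choose a ha b hb hxa using hx
  obtain ⟨y, hy⟩ := exists_lp_of_norm_le fun n => hR _ (ha n)
  obtain ⟨z, hz⟩ := exists_lp_of_norm_le fun n => hR' _ (hb n)
  refine ⟨_, ⟨y, fun n => by rw [hy]; exact ha n, rfl⟩, _,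
    ⟨z, fun n => by rw [hz]; exact hb n, rfl⟩, ?_⟩
  change (nullSequences U X).mkQ y + (nullSequences U X).mkQ z = _
  rw [← map_add]
  congr 1
  ext n
  rw [← hxa n]
  change y n + z n = a n + b n
  rw [hy, hz]

lemma Gam_mono {A B : Set X} (hB : Bornology.IsBounded B) (h : A ⊆ B) : Gam U A ≤ Gam U B :=
  gammaMeasure_mono (isBounded_setUltrapower U hB) (setUltrapower_mono U h)

end SetUltrapower

/-! ### Separated finite sequences as a criterion for Γ. -/

section SeparatedSequences

/-- `A` contains sequences of every finite length whose initial and final segments are separated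
by `β` by functionals of norm at most one. -/
def HasSeparatedSequences {X : Type*} [NormedAddCommGroup X] [NormedSpace ℝ X]
    (A : Set X) (β : ℝ) : Prop :=
  ∀ n : ℕ, ∃ (x : ℕ → X) (f : ℕ → StrongDual ℝ X), (∀ i < n, x i ∈ A) ∧ (∀ m, ‖f m‖ ≤ 1) ∧
    ∀ i m j, i < m → m ≤ j → j < n → β ≤ f m (x j) - f m (x i)

section Bidual

variable {E : Type*} [NormedAddCommGroup E] [NormedSpace ℝ E]

lemma mem_bidualWeakStarClosure_of_tendsto {S : Set E} {z : StrongDual ℝ (StrongDual ℝ E)}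
    {ι : Type*} {l : Filter ι} [l.NeBot] {ξ : ι → E} (hξ : ∀ i, ξ i ∈ S)
    (h : ∀ f : StrongDual ℝ E, Tendsto (fun i => f (ξ i)) l (𝓝 (z f))) :
    z ∈ bidualWeakStarClosure S := by
  have ht : Tendsto (fun i => (StrongDual.toWeakDual
        (NormedSpace.inclusionInDoubleDual ℝ E (ξ i)) : WeakDual ℝ (StrongDual ℝ E))) l
      (𝓝 (StrongDual.toWeakDual z : WeakDual ℝ (StrongDual ℝ E))) :=
    tendsto_iff_forall_eval_tendsto_topDualPairing.2 h
  exact mem_closure_of_tendsto (X := WeakDual ℝ (StrongDual ℝ E)) ht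
    (Eventually.of_forall fun i => ⟨_, ⟨_, hξ i, rfl⟩, rfl⟩)

lemma exists_mem_forall_abs_sub_lt {S : Set E} {z : StrongDual ℝ (StrongDual ℝ E)}
    (hz : z ∈ bidualWeakStarClosure S) (F : Finset (StrongDual ℝ E)) {δ : ℝ} (hδ : 0 < δ) :
    ∃ x ∈ S, ∀ f ∈ F, |f x - z f| < δ := by
  have hopen : ∀ᶠ w in 𝓝 (StrongDual.toWeakDual z : WeakDual ℝ (StrongDual ℝ E)),
      ∀ f ∈ F, |w f - z f| < δ := by
    refine (Finset.eventually_all F).2 fun f _ => ?_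
    have hc := (WeakDual.eval_continuous (𝕜 := ℝ) (E := StrongDual ℝ E) f).tendsto
      (StrongDual.toWeakDual z)
    exact Metric.tendsto_nhds.1 hc δ hδ
  obtain ⟨_, hw, _, ⟨x, hx, rfl⟩, rfl⟩ :=
    (mem_closure_iff_nhds (X := WeakDual ℝ (StrongDual ℝ E))).1 hz _ hopen
  exact ⟨x, hx, hw⟩

/-- Otherwise z has norm at most t on the annihilator of F. Let y be a Hahn–Banach extension of this
restriction with norm at most t. Then `z - y` vanishes on a common kernel of finitely many
evaluations, so it is evaluation at some e, and z is within t of e. -/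
lemma exists_functional_vanishing {z : StrongDual ℝ (StrongDual ℝ E)} {t : ℝ} (ht : 0 ≤ t)
    (hz : ∀ e : E, ¬ IsNear z e t) (F : Finset E) :
    ∃ f : StrongDual ℝ E, ‖f‖ ≤ 1 ∧ (∀ e ∈ F, f e = 0) ∧ t < z f := by
  by_contra! hcon
  let L : E →ₗ[ℝ] (StrongDual ℝ E →ₗ[ℝ] ℝ) :=
    { toFun := fun e =>
        { toFun := fun f => f e
          map_add' := fun _ _ => rfl
          map_smul' := fun _ _ => rfl }
      map_add' := fun a b => LinearMap.ext fun f => map_add f a b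
      map_smul' := fun c a => LinearMap.ext fun f => map_smul f c a }
  let p : Submodule ℝ (StrongDual ℝ E) := ⨅ e : F, LinearMap.ker (L e)
  have hp : ∀ {f}, f ∈ p ↔ ∀ e ∈ F, f e = 0 := by
    intro f
    simp [p, L, Submodule.mem_iInf]
  have hle : ∀ f ∈ p, z f ≤ t * ‖f‖ := by
    intro f hf
    rcases eq_or_ne f 0 with rfl | hf0
    · simp
    · have hn : 0 < ‖f‖ := norm_pos_iff.2 hf0
      have h1 := hcon (‖f‖⁻¹ • f) (by rw [norm_smul, norm_inv, norm_norm, inv_mul_cancel₀ hn.ne'])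
        (hp.1 (p.smul_mem _ hf))
      rw [map_smul, smul_eq_mul, inv_mul_le_iff₀ hn] at h1
      linarith
  have habs : ∀ f : p, ‖(z.comp p.subtypeL) f‖ ≤ t * ‖f‖ := by
    intro f
    refine abs_le.2 ⟨?_, hle f f.2⟩
    have := hle (-f) (p.neg_mem f.2)
    rw [map_neg, norm_neg] at this
    change -(t * ‖(f : StrongDual ℝ E)‖) ≤ z f
    linarith
  obtain ⟨y, hy, hyn⟩ := exists_extension_norm_eq p (z.comp p.subtypeL)
  have hyt : ‖y‖ ≤ t := hyn.trans_le (ContinuousLinearMap.opNorm_le_bound _ ht habs)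
  let φ : StrongDual ℝ E →ₗ[ℝ] ℝ := (z : StrongDual ℝ E →ₗ[ℝ] ℝ) - (y : StrongDual ℝ E →ₗ[ℝ] ℝ)
  have hφ : p ≤ LinearMap.ker φ := by
    intro f hf
    have : y f = z f := hy ⟨f, hf⟩
    change z f - y f = 0
    rw [this, sub_self]
  have hspan : φ ∈ Submodule.span ℝ (Set.range fun e : F => L e) :=
    mem_span_of_iInf_ker_le_ker hφ
  have hrange : Submodule.span ℝ (Set.range fun e : F => L e) ≤ LinearMap.range L := by
    rw [Submodule.span_le]
    rintro _ ⟨e, rfl⟩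
    exact ⟨e, rfl⟩
  obtain ⟨e, he⟩ := hrange hspan
  refine hz e fun f => ?_
  have h1 : f e = z f - y f := LinearMap.congr_fun he f
  rw [h1, sub_sub_cancel]
  exact y.le_of_opNorm_le hyt f

lemma exists_separated_sequence_of_lt_gammaMeasure {S : Set E} {t s : ℝ} (ht : 0 < t)
    (hS : t < gammaMeasure S) (hs : s < t) :
    ∃ (x : ℕ → E) (f : ℕ → StrongDual ℝ E), (∀ i, x i ∈ S) ∧ (∀ m, ‖f m‖ ≤ 1) ∧
      ∀ i m j, i < m → m ≤ j → s ≤ f m (x j) - f m (x i) := by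
  classical
  obtain ⟨z, hz, hfar⟩ := exists_not_isNear_of_lt_gammaMeasure ht hS
  obtain ⟨p, hp, hr⟩ := exists_seq_of_forall_finset_exists
    (fun p : E × StrongDual ℝ E => p.1 ∈ S ∧ ‖p.2‖ ≤ 1 ∧ s ≤ p.2 p.1)
    -- New functionals vanish on old points; new points imitate z on old functionals. The last
    -- clause, available once some index precedes m, discharges the premise of the middle one.
    (fun p q => q.2 p.1 = 0 ∧ (t < z p.2 → s ≤ p.2 q.1) ∧ t < z q.2) (by
      intro F _
      obtain ⟨f, hf1, hf0, hft⟩ := exists_functional_vanishing ht.le hfar (F.image Prod.fst)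
      obtain ⟨x, hx, hxF⟩ := exists_mem_forall_abs_sub_lt hz (insert f (F.image Prod.snd))
        (sub_pos.2 hs)
      refine ⟨(x, f), ⟨hx, hf1, ?_⟩, fun q hq => ⟨hf0 _ (Finset.mem_image_of_mem _ hq), ?_, hft⟩⟩
      · have := (abs_lt.1 (hxF f (Finset.mem_insert_self _ _))).1
        linarith
      · intro hq'
        have := (abs_lt.1 (hxF q.2
          (Finset.mem_insert_of_mem (Finset.mem_image_of_mem _ hq)))).1
        linarith)
  refine ⟨fun i => (p i).1, fun m => (p m).2, fun i => (hp i).1, fun m => (hp m).2.1, ?_⟩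
  intro i m j him hmj
  have h0 := (hr i m him).1
  have h1 : t < z (p m).2 := (hr i m him).2.2
  have h2 : s ≤ (p m).2 (p j).1 := by
    rcases hmj.eq_or_lt with rfl | hlt
    · exact (hp m).2.2
    · exact (hr m j hlt).2.1 h1
  linarith

end Bidual

variable {X : Type*} [NormedAddCommGroup X] [NormedSpace ℝ X]

/-- Either the ball of radius c meets the convex hull of the vectors, or Hahn–Banach separates the
two and the functional can be rescaled. -/
lemma exists_functional_or_exists_weights {ι : Type*} [Fintype ι] (v : ι → X) {c : ℝ}
    (hc : 0 < c) :
    (∃ g : StrongDual ℝ X, ‖g‖ ≤ 1 ∧ ∀ p, c ≤ g (v p)) ∨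
      ∃ w ∈ stdSimplex ℝ ι, ‖∑ p, w p • v p‖ < c := by
  classical
  let T : Set X := (fun w : ι → ℝ => ∑ p, w p • v p) '' stdSimplex ℝ ι
  by_cases hd : Disjoint (Metric.ball (0 : X) c) T
  · left
    have hT : Convex ℝ T := by
      have : T = (Fintype.linearCombination ℝ v) '' stdSimplex ℝ ι := by
        refine Set.image_congr fun w _ => ?_
        rw [Fintype.linearCombination_apply]
      rw [this]
      exact (convex_stdSimplex ℝ ι).linear_image _
    obtain ⟨g, u, hgu, hug⟩ := geometric_hahn_banach_open (convex_ball 0 c) Metric.isOpen_ball hT hd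
    have hu : 0 < u := by simpa using hgu 0 (Metric.mem_ball_self hc)
    have hclosed : ∀ x ∈ Metric.closedBall (0 : X) c, g x ≤ u := by
      rw [← closure_ball 0 hc.ne']
      exact fun x hx => closure_minimal (fun y hy => (hgu y hy).le)
        (isClosed_le g.continuous continuous_const) hx
    have hnorm : ‖g‖ ≤ u / c := by
      refine ContinuousLinearMap.opNorm_bound_of_ball_bound hc u g fun x hx => ?_
      refine abs_le.2 ⟨?_, hclosed x hx⟩
      have := hclosed (-x) (by simpa using hx)
      rw [map_neg] at this
      linarith
    refine ⟨(c / u) • g, ?_, fun p => ?_⟩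
    · rw [norm_smul, Real.norm_eq_abs, abs_of_pos (div_pos hc hu)]
      calc c / u * ‖g‖ ≤ c / u * (u / c) := mul_le_mul_of_nonneg_left hnorm (div_pos hc hu).le
        _ = 1 := by field_simp
    · have h1 : u ≤ g (v p) := by
        refine hug _ ⟨Pi.single p 1, single_mem_stdSimplex ℝ p, ?_⟩
        simp [Pi.single_apply]
      change c ≤ c / u * g (v p)
      calc c = c / u * u := by field_simp
        _ ≤ _ := mul_le_mul_of_nonneg_left h1 (div_pos hc hu).le
  · right
    obtain ⟨_, h1, w, hw, rfl⟩ := Set.not_disjoint_iff.1 hd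
    exact ⟨w, hw, by simpa using h1⟩

variable (U : Ultrafilter ℕ)

/-- Replaces one functional on the ultrapower by functionals on X. If these failed to exist for
U-many k, there would be weights with combinations of norm below c. Their limit in the compact
simplex gives a combination in the ultrapower of norm below b, on which f is at least b. -/
lemma eventually_exists_functional {ι : Type*} [Fintype ι] (Z : ι → lp (fun _ : ℕ => X) ∞)
    {f : StrongDual ℝ (Ultrapower U X)} (hf : ‖f‖ ≤ 1) {b c : ℝ} (hcb : c < b)
    (hb : ∀ p, b ≤ f ((nullSequences U X).mkQ (Z p))) :
    ∀ᶠ k in (U : Filter ℕ), ∃ g : StrongDual ℝ X, ‖g‖ ≤ 1 ∧ ∀ p, c ≤ g (Z p k) := by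
  rcases le_or_gt c 0 with hc | hc
  -- The alternative on weights needs a ball of positive radius; otherwise the zero functional
  -- suffices.
  · exact Eventually.of_forall fun k => ⟨0, by simp, fun p => by simpa using hc⟩
  by_contra hcon
  rw [← Ultrafilter.eventually_not] at hcon
  have hw : ∀ᶠ k in (U : Filter ℕ), ∃ w ∈ stdSimplex ℝ ι, ‖∑ p, w p • Z p k‖ < c :=
    hcon.mono fun k hk => (exists_functional_or_exists_weights (fun p => Z p k) hc).resolve_left hk
  obtain ⟨w₀, hw₀, -⟩ := hw.exists.choose_spec
  have hw' : ∀ k, ∃ w ∈ stdSimplex ℝ ι, (∃ w' ∈ stdSimplex ℝ ι, ‖∑ p, w' p • Z p k‖ < c) →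
      ‖∑ p, w p • Z p k‖ < c := by
    intro k
    by_cases h : ∃ w' ∈ stdSimplex ℝ ι, ‖∑ p, w' p • Z p k‖ < c
    · obtain ⟨w', h1, h2⟩ := h
      exact ⟨w', h1, fun _ => h2⟩
    · exact ⟨w₀, hw₀, fun h' => absurd h' h⟩
  choose w hwS hwc using hw'
  obtain ⟨w', hw'S, hlim⟩ := (isCompact_stdSimplex ℝ ι).ultrafilter_le_nhds' (U.map w)
    (Ultrafilter.mem_map.2 (Filter.univ_mem' hwS))
  have hlim : Tendsto w (U : Filter ℕ) (𝓝 w') := hlim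
  have hsmall : Tendsto (fun k => ∑ p, |w' p - w k p| * ‖Z p‖) (U : Filter ℕ) (𝓝 0) := by
    have h1 : ∀ p, Tendsto (fun k => |w' p - w k p| * ‖Z p‖) (U : Filter ℕ) (𝓝 0) := fun p => by
      have h2 : Tendsto (fun k => w k p) (U : Filter ℕ) (𝓝 (w' p)) := (tendsto_pi_nhds.1 hlim) p
      have h3 := ((tendsto_const_nhds (x := w' p)).sub h2).abs.mul_const ‖Z p‖
      simpa using h3
    simpa using tendsto_finsetSum Finset.univ fun p _ => h1 p
  have hη : 0 < (b - c) / 2 := by linarith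
  have hev : ∀ᶠ k in (U : Filter ℕ), ‖(∑ p, w' p • Z p) k‖ ≤ c + (b - c) / 2 := by
    filter_upwards [hw, hsmall.eventually (gt_mem_nhds hη)] with k hk hs
    have h1 := hwc k hk
    have h2 : (∑ p, w' p • Z p) k = ∑ p, w k p • Z p k + ∑ p, (w' p - w k p) • Z p k := by
      rw [← Finset.sum_add_distrib, lp.coeFn_sum, Finset.sum_apply]
      refine Finset.sum_congr rfl fun p _ => ?_
      rw [← add_smul, add_sub_cancel]
      rfl
    have h3 : ‖∑ p, (w' p - w k p) • Z p k‖ ≤ ∑ p, |w' p - w k p| * ‖Z p‖ := by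
      refine norm_sum_le_of_le _ fun p _ => ?_
      rw [norm_smul, Real.norm_eq_abs]
      exact mul_le_mul_of_nonneg_left (norm_apply_le_norm_of_lp (Z p) k) (abs_nonneg _)
    rw [h2]
    linarith [norm_add_le (∑ p, w k p • Z p k) (∑ p, (w' p - w k p) • Z p k)]
  have hnorm := norm_mkQ_le_of_eventually U (by linarith) hev
  have hfb : b ≤ f ((nullSequences U X).mkQ (∑ p, w' p • Z p)) := by
    rw [map_sum, map_sum]
    simp_rw [map_smul, smul_eq_mul]
    calc b = ∑ p, w' p * b := by rw [← Finset.sum_mul, hw'S.2, one_mul]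
      _ ≤ _ := Finset.sum_le_sum fun p _ => mul_le_mul_of_nonneg_left (hb p) (hw'S.1 p)
  have := (le_abs_self _).trans (f.le_of_opNorm_le hf ((nullSequences U X).mkQ (∑ p, w' p • Z p)))
  linarith

lemma hasSeparatedSequences_of_lt_Gam {A : Set X} {t s : ℝ} (ht : 0 < t) (hA : t < Gam U A)
    (hs : s < t) : HasSeparatedSequences A s := by
  intro n
  obtain ⟨ξ, f, hξ, hf, hsep⟩ := exists_separated_sequence_of_lt_gammaMeasure ht hA
    (show (s + t) / 2 < t by linarith)
  choose Y hY hYξ using hξ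
  have hev : ∀ᶠ k in (U : Filter ℕ), ∀ m ∈ Finset.range n, ∃ g : StrongDual ℝ X, ‖g‖ ≤ 1 ∧
      ∀ p : {p : Fin n × Fin n // p.1.1 < m ∧ m ≤ p.2.1}, s ≤ g ((Y p.1.2 - Y p.1.1) k) := by
    refine (Finset.eventually_all _).2 fun m _ => ?_
    refine eventually_exists_functional U (b := (s + t) / 2)
      (fun p : {p : Fin n × Fin n // p.1.1 < m ∧ m ≤ p.2.1} => Y p.1.2 - Y p.1.1) (hf m)
      (by linarith) fun p => ?_
    rw [map_sub, map_sub, hYξ, hYξ]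
    exact hsep _ _ _ p.2.1 p.2.2
  obtain ⟨k, hk⟩ := hev.exists
  have hk' : ∀ m, ∃ g : StrongDual ℝ X, ‖g‖ ≤ 1 ∧ (m < n →
      ∀ p : {p : Fin n × Fin n // p.1.1 < m ∧ m ≤ p.2.1}, s ≤ g ((Y p.1.2 - Y p.1.1) k)) := by
    intro m
    by_cases hm : m < n
    · obtain ⟨g, h1, h2⟩ := hk m (Finset.mem_range.2 hm)
      exact ⟨g, h1, fun _ => h2⟩
    · exact ⟨0, by simp, fun h => absurd h hm⟩
  choose g hg1 hg using hk'
  refine ⟨fun i => Y i k, g, fun i _ => hY i k, hg1, fun i m j him hmj hjn => ?_⟩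
  have := hg m (hmj.trans_lt hjn)
    ⟨(⟨i, (him.trans_le hmj).trans hjn⟩, ⟨j, hjn⟩), him, hmj⟩
  rw [← map_sub]
  exact this

lemma eventually_gt_of_isFree {U : Ultrafilter ℕ} (hU : IsFree U) (j : ℕ) :
    ∀ᶠ n in (U : Filter ℕ), j < n :=
  hU (by rw [Nat.cofinite_eq_atTop]; exact eventually_gt_atTop j)

/-- Take ultralimits z of the points and φ of the functionals, then let j, m and i run along U in
this order. Exchanging z for a point e within t costs t at each `F m` and again at φ, whence the
factor 2. -/
lemma le_two_mul_gammaMeasure_of_separated {U : Ultrafilter ℕ} (hU : IsFree U) {E : Type*}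
    [NormedAddCommGroup E] [NormedSpace ℝ E] {S : Set E} (hS : Bornology.IsBounded S) {β : ℝ}
    {ξ : ℕ → E} {F : ℕ → StrongDual ℝ E} (hξ : ∀ i, ξ i ∈ S) (hF : ∀ m, ‖F m‖ ≤ 1)
    (hsep : ∀ i m j, i < m → m ≤ j → β ≤ F m (ξ j) - F m (ξ i)) : β ≤ 2 * gammaMeasure S := by
  obtain ⟨R, hR⟩ := hS.exists_norm_le
  obtain ⟨z, -, hz⟩ := exists_ultralimit_functional U
    (g := fun j => NormedSpace.inclusionInDoubleDual ℝ E (ξ j)) (C := R)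
    fun j => (NormedSpace.double_dual_bound ℝ _ _).trans (hR _ (hξ j))
  obtain ⟨φ, hφ1, hφ⟩ := exists_ultralimit_functional U hF
  have hzmem : z ∈ bidualWeakStarClosure S := mem_bidualWeakStarClosure_of_tendsto hξ hz
  by_contra! hlt
  obtain ⟨t, ht1, ht2⟩ := exists_between (show gammaMeasure S < β / 2 by linarith)
  have ht0 : 0 ≤ t := (gammaMeasure_nonneg _).trans ht1.le
  obtain ⟨e, he⟩ := exists_isNear_of_gammaMeasure_lt hS ht1 hzmem
  have hnear : ∀ g : StrongDual ℝ E, ‖g‖ ≤ 1 → |z g - g e| ≤ t := fun g hg =>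
    (he g).trans (mul_le_of_le_one_right ht0 hg)
  have h1 : ∀ i m, i < m → β ≤ z (F m) - F m (ξ i) := fun i m him => by
    refine ge_of_tendsto ((hz (F m)).sub_const _) ?_
    filter_upwards [eventually_gt_of_isFree hU m] with j hj
    exact hsep i m j him hj.le
  have h2 : ∀ i, β ≤ φ e + t - φ (ξ i) := fun i => by
    refine ge_of_tendsto (((hφ e).add_const t).sub (hφ (ξ i))) ?_
    filter_upwards [eventually_gt_of_isFree hU i] with m hm
    linarith [h1 i m hm, (abs_le.1 (hnear (F m) (hF m))).2]
  have h3 : β ≤ φ e + t - z φ :=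
    ge_of_tendsto ((tendsto_const_nhds (x := φ e + t)).sub (hz φ)) (Eventually.of_forall h2)
  linarith [(abs_le.1 (hnear φ hφ1)).1]

lemma HasSeparatedSequences.le_two_mul_Gam {U : Ultrafilter ℕ} (hU : IsFree U) {A : Set X}
    (hA : Bornology.IsBounded A) {β : ℝ} (h : HasSeparatedSequences A β) : β ≤ 2 * Gam U A := by
  classical
  choose x f hx hf hsep using h
  obtain ⟨R, hR⟩ := hA.exists_norm_le
  -- The sequence of length one supplies a default point of A; it is used only for `n ≤ i`, which a
  -- free ultrafilter ignores.
  have hmem : ∀ i n, (if i < n then x n i else x 1 0) ∈ A := fun i n => by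
    split_ifs with h
    exacts [hx n i h, hx 1 0 one_pos]
  have hY : ∀ i, ∃ y : lp (fun _ : ℕ => X) ∞, ∀ n, y n = if i < n then x n i else x 1 0 := fun i =>
    exists_lp_of_norm_le fun n => hR _ (hmem i n)
  choose Y hY using hY
  have hF := fun m => exists_ultraproduct_functional U (g := fun n => f n m) fun n => hf n m
  choose F hF1 hF using hF
  refine le_two_mul_gammaMeasure_of_separated hU (isBounded_setUltrapower U hA)
    (ξ := fun i => (nullSequences U X).mkQ (Y i)) (F := F)
    (fun i => ⟨Y i, fun n => by rw [hY]; exact hmem i n, rfl⟩) hF1 fun i m j him hmj => ?_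
  refine ge_of_tendsto ((hF m (Y j)).sub (hF m (Y i))) ?_
  filter_upwards [eventually_gt_of_isFree hU j] with n hn
  rw [hY, hY, if_pos hn, if_pos ((him.trans_le hmj).trans hn)]
  exact hsep n i m j him hmj hn

end SeparatedSequences

/-! ### Cauchy convex blocks in inner product spaces. -/

section ConvexBlocks

/-- In an inner product space, every bounded sequence has convex blocks forming a Cauchy
sequence. -/
lemma exists_cauchySeq_convexHull {H : Type*} [NormedAddCommGroup H] [InnerProductSpace ℝ H]
    {p : ℕ → H} {R : ℝ} (hp : ∀ n, ‖p n‖ ≤ R) :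
    ∃ q : ℕ → H, (∀ k, q k ∈ convexHull ℝ (p '' Ici k)) ∧ CauchySeq q := by
  set C : ℕ → Set H := fun k => convexHull ℝ (p '' Ici k) with hC
  have hne : ∀ k, p k ∈ C k := fun k => subset_convexHull ℝ _ ⟨k, self_mem_Ici, rfl⟩
  have hanti : ∀ {k l}, k ≤ l → C l ⊆ C k := fun hkl =>
    convexHull_mono (image_mono (Ici_subset_Ici.2 hkl))
  set d : ℕ → ℝ := fun k => sInf (norm '' C k) with hd
  have hbdd : ∀ k, BddBelow (norm '' C k) := fun k =>
    ⟨0, by rintro _ ⟨x, -, rfl⟩; exact norm_nonneg x⟩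
  have hdle : ∀ {k x}, x ∈ C k → d k ≤ ‖x‖ := fun hx => csInf_le (hbdd _) ⟨_, hx, rfl⟩
  have hd0 : ∀ k, 0 ≤ d k := fun k =>
    Real.sInf_nonneg (by rintro _ ⟨x, -, rfl⟩; exact norm_nonneg x)
  have hdmono : Monotone d := fun k l hkl =>
    csInf_le_csInf (hbdd k) ⟨_, _, hne l, rfl⟩ (image_mono (hanti hkl))
  have hdR : ∀ k, d k ≤ R := fun k => (hdle (hne k)).trans (hp k)
  obtain ⟨D, hD⟩ : ∃ D, Tendsto d atTop (𝓝 D) :=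
    ⟨_, tendsto_atTop_ciSup hdmono ⟨R, by rintro _ ⟨k, rfl⟩; exact hdR k⟩⟩
  have hq : ∀ k : ℕ, ∃ x ∈ C k, ‖x‖ < d k + 1 / ((k : ℝ) + 1) := fun k => by
    obtain ⟨_, ⟨x, hx, rfl⟩, hlt⟩ := exists_lt_of_csInf_lt
      (⟨_, _, hne k, rfl⟩ : (norm '' C k).Nonempty)
      (show sInf (norm '' C k) < d k + 1 / ((k : ℝ) + 1) from lt_add_of_pos_right _ (by positivity))
    exact ⟨x, hx, hlt⟩
  choose q hqC hqd using hq
  refine ⟨q, hqC, ?_⟩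
  have hb : Tendsto (fun k : ℕ => d k + 1 / ((k : ℝ) + 1)) atTop (𝓝 D) := by
    simpa using hD.add tendsto_one_div_add_atTop_nhds_zero_nat
  have hsq : Tendsto (fun k : ℕ => 2 * ((d k + 1 / ((k : ℝ) + 1)) ^ 2 - d k ^ 2)) atTop (𝓝 0) := by
    simpa using ((hb.pow 2).sub (hD.pow 2)).const_mul 2
  have hgap : Tendsto (fun kl : ℕ × ℕ => 2 * (d kl.2 ^ 2 - d kl.1 ^ 2)) atTop (𝓝 0) := by
    have h2 : Tendsto (fun kl : ℕ × ℕ => d kl.2) atTop (𝓝 D) := by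
      rw [← prod_atTop_atTop_eq]
      exact hD.comp tendsto_snd
    have h1 : Tendsto (fun kl : ℕ × ℕ => d kl.1) atTop (𝓝 D) := by
      rw [← prod_atTop_atTop_eq]
      exact hD.comp tendsto_fst
    simpa using ((h2.pow 2).sub (h1.pow 2)).const_mul 2
  -- The midpoint of `q k` and `q l` stays in `C k`, so its norm is at least `d k`; the
  -- parallelogram law turns near-minimality and the convergence of d into a Cauchy estimate.
  have hpar : ∀ k l, k ≤ l → ‖q k - q l‖ ^ 2 ≤
      2 * ((d k + 1 / ((k : ℝ) + 1)) ^ 2 - d k ^ 2) +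
      2 * ((d l + 1 / ((l : ℝ) + 1)) ^ 2 - d l ^ 2) + 2 * (d l ^ 2 - d k ^ 2) := by
    intro k l hkl
    have hmid : (1 / 2 : ℝ) • q k + (1 / 2 : ℝ) • q l ∈ C k :=
      convex_convexHull ℝ _ (hqC k) (hanti hkl (hqC l)) (by norm_num) (by norm_num) (by norm_num)
    have h1 : 2 * d k ≤ ‖q k + q l‖ := by
      have h := hdle hmid
      rw [← smul_add, norm_smul] at h
      norm_num at h
      linarith
    have h2 := parallelogram_law_with_norm ℝ (q k) (q l)
    have h3 : ‖q k‖ ^ 2 ≤ (d k + 1 / ((k : ℝ) + 1)) ^ 2 :=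
      pow_le_pow_left₀ (norm_nonneg _) (hqd k).le 2
    have h4 : ‖q l‖ ^ 2 ≤ (d l + 1 / ((l : ℝ) + 1)) ^ 2 :=
      pow_le_pow_left₀ (norm_nonneg _) (hqd l).le 2
    have h5 : (2 * d k) ^ 2 ≤ ‖q k + q l‖ ^ 2 :=
      pow_le_pow_left₀ (mul_nonneg zero_le_two (hd0 k)) h1 2
    nlinarith
  refine Metric.cauchySeq_iff'.2 fun ε hε => ?_
  have hε2 : 0 < ε ^ 2 / 3 := by positivity
  obtain ⟨N₁, hN₁⟩ := eventually_atTop.1 (hsq.eventually (gt_mem_nhds hε2))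
  obtain ⟨N₂, hN₂⟩ := eventually_atTop.1 (hgap.eventually (gt_mem_nhds hε2))
  refine ⟨max N₁ (max N₂.1 N₂.2), fun l hl => ?_⟩
  set k := max N₁ (max N₂.1 N₂.2) with hk
  have h1 := hN₁ k (le_max_left _ _)
  have h2 := hN₁ l ((le_max_left _ _).trans hl)
  have h3 := hN₂ (k, l) ⟨(le_max_left _ _).trans (le_max_right _ _),
    ((le_max_right _ _).trans (le_max_right _ _)).trans hl⟩
  rw [dist_comm, dist_eq_norm]
  refine lt_of_pow_lt_pow_left₀ 2 hε.le ((hpar k l hl).trans_lt ?_)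
  simp only at h3
  linarith

end ConvexBlocks

/-! ### Almost everywhere convergent convex blocks of continuous functions. -/

section MeasureTheory

open MeasureTheory

variable {Q : Type*} [TopologicalSpace Q] [CompactSpace Q] [MeasurableSpace Q] [BorelSpace Q]

/-- A bounded sequence of continuous functions has convex blocks that converge almost everywhere
with respect to countably many given finite measures. -/
lemma exists_ae_tendsto_convexHull [SecondCountableTopology Q] {π : ℕ → C(Q, ℝ)} {R : ℝ}
    (hπ : ∀ m, ‖π m‖ ≤ R) {ι : Type*} [Countable ι] (μ : ι → Measure Q)
    [∀ i, IsFiniteMeasure (μ i)] :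
    ∃ (g : ℕ → C(Q, ℝ)) (F : Q → ℝ), (∀ k, g k ∈ convexHull ℝ (π '' Ici k)) ∧ Measurable F ∧
      ∀ i, ∀ᵐ y ∂(μ i), Tendsto (fun k => g k y) atTop (𝓝 (F y)) := by
  -- A single finite measure whose null sets are null for every `μ i`, so that one L² space serves
  -- them all.
  set ρ := (Measure.sum μ).toFinite with hρ
  have hae : ∀ {P : Q → Prop}, (∀ᵐ y ∂ρ, P y) → ∀ i, ∀ᵐ y ∂(μ i), P y := by
    intro P hP i
    rw [hρ, ae_toFinite] at hP
    exact ae_mono (Measure.le_sum μ i) hP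
  let L : C(Q, ℝ) →L[ℝ] Lp ℝ 2 ρ := ContinuousMap.toLp 2 ρ ℝ
  obtain ⟨q, hq, hcau⟩ := exists_cauchySeq_convexHull (p := fun m => L (π m)) (R := ‖L‖ * R)
    fun m => (L.le_opNorm _).trans (mul_le_mul_of_nonneg_left (hπ m) (norm_nonneg _))
  have hg : ∀ k, ∃ g ∈ convexHull ℝ (π '' Ici k), L g = q k := by
    intro k
    have h : q k ∈ (L : C(Q, ℝ) →ₗ[ℝ] Lp ℝ 2 ρ) '' convexHull ℝ (π '' Ici k) := by
      rw [LinearMap.image_convexHull, Set.image_image]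
      exact hq k
    exact h
  choose g hgmem hgq using hg
  obtain ⟨Φ, hΦ⟩ := cauchySeq_tendsto_of_complete hcau
  -- Since `k ≤ ns k`, the subsequence still consists of blocks of the tails.
  obtain ⟨ns, hns, hlim⟩ := (tendstoInMeasure_of_tendsto_Lp hΦ).exists_seq_tendsto_ae
  refine ⟨fun k => g (ns k), Φ, fun k => ?_, (Lp.stronglyMeasurable Φ).measurable, hae ?_⟩
  · exact convexHull_mono (image_mono (Ici_subset_Ici.2 (hns.id_le k))) (hgmem (ns k))
  · have hcoe : ∀ᵐ y ∂ρ, ∀ k, q k y = g k y := by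
      refine ae_all_iff.2 fun k => ?_
      rw [← hgq k]
      exact ContinuousMap.coeFn_toLp ρ (g k)
    filter_upwards [hlim, hcoe] with y hy hc
    simpa only [hc] using hy

lemma tendsto_integral_continuousMap {ι : Type*} {l : Filter ι} {μ : ι → ProbabilityMeasure Q}
    {ν : ProbabilityMeasure Q} (h : Tendsto μ l (𝓝 ν)) (f : C(Q, ℝ)) :
    Tendsto (fun i => ∫ y, f y ∂(μ i : Measure Q)) l (𝓝 (∫ y, f y ∂(ν : Measure Q))) :=
  ProbabilityMeasure.tendsto_iff_forall_integral_tendsto.1 h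
    (BoundedContinuousFunction.mkOfCompact f)

lemma integrable_continuousMap (f : C(Q, ℝ)) (μ : Measure Q) [IsFiniteMeasure μ] :
    Integrable f μ :=
  (BoundedContinuousFunction.mkOfCompact f).integrable μ

omit [MeasurableSpace Q] [BorelSpace Q] in
lemma norm_le_of_mem_convexHull_image {π : ℕ → C(Q, ℝ)} {R : ℝ} (hπ : ∀ m, ‖π m‖ ≤ R) {s : Set ℕ}
    {g : C(Q, ℝ)} (hg : g ∈ convexHull ℝ (π '' s)) : ‖g‖ ≤ R := by
  have : convexHull ℝ (π '' s) ⊆ Metric.closedBall 0 R :=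
    convexHull_min (by rintro _ ⟨m, -, rfl⟩; simpa using hπ m) (convex_closedBall _ _)
  simpa using this hg

lemma le_integral_sub_of_mem_convexHull {π : ℕ → C(Q, ℝ)} {μ ν : Measure Q} [IsFiniteMeasure μ]
    [IsFiniteMeasure ν] {β : ℝ} {s : Set ℕ}
    (h : ∀ m ∈ s, (∫ y, π m y ∂μ) + β ≤ ∫ y, π m y ∂ν) {g : C(Q, ℝ)}
    (hg : g ∈ convexHull ℝ (π '' s)) : (∫ y, g y ∂μ) + β ≤ ∫ y, g y ∂ν := by
  have hconv : Convex ℝ {g : C(Q, ℝ) | (∫ y, g y ∂μ) + β ≤ ∫ y, g y ∂ν} := by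
    intro f hf g hg a b ha hb hab
    have key : ∀ (ρ : Measure Q) [IsFiniteMeasure ρ],
        ∫ y, (a • f + b • g) y ∂ρ = a * ∫ y, f y ∂ρ + b * ∫ y, g y ∂ρ := by
      intro ρ _
      simp only [ContinuousMap.add_apply, ContinuousMap.smul_apply, smul_eq_mul]
      rw [integral_add ((integrable_continuousMap f ρ).const_mul a)
        ((integrable_continuousMap g ρ).const_mul b), integral_const_mul, integral_const_mul]
    change (∫ y, (a • f + b • g) y ∂μ) + β ≤ ∫ y, (a • f + b • g) y ∂ν
    rw [key, key]
    have h1 := mul_le_mul_of_nonneg_left (show _ ≤ _ from hf) ha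
    have h2 := mul_le_mul_of_nonneg_left (show _ ≤ _ from hg) hb
    have h3 : β = a * β + b * β := by rw [← add_mul, hab, one_mul]
    linarith
  exact convexHull_min (by rintro _ ⟨m, hm, rfl⟩; exact h m hm) hconv hg

end MeasureTheory

/-! ### Lipschitz minorants and drops of a measurable function. -/

section Envelope

variable {Q : Type*} [MetricSpace Q]

/-- The largest `k`-Lipschitz minorant of `F` on `G`. -/
noncomputable def lipschitzMinorant (F : Q → ℝ) (G : Set Q) (k : ℕ) (y : Q) : ℝ :=
  ⨅ z : G, (F z + k * dist y z)

variable {F : Q → ℝ} {G : Set Q} {R : ℝ}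

lemma bddBelow_lipschitzMinorant (hF : ∀ z ∈ G, |F z| ≤ R) (k : ℕ) (y : Q) :
    BddBelow (Set.range fun z : G => F z + k * dist y z) := by
  refine ⟨-R, ?_⟩
  rintro _ ⟨z, rfl⟩
  have h1 := (abs_le.1 (hF z z.2)).1
  have h2 : 0 ≤ (k : ℝ) * dist y z := by positivity
  change -R ≤ F z + k * dist y z
  linarith

lemma lipschitzMinorant_le (hF : ∀ z ∈ G, |F z| ≤ R) (k : ℕ) (y : Q) {z : Q} (hz : z ∈ G) :
    lipschitzMinorant F G k y ≤ F z + k * dist y z :=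
  ciInf_le (bddBelow_lipschitzMinorant hF k y) ⟨z, hz⟩

lemma neg_le_lipschitzMinorant (hF : ∀ z ∈ G, |F z| ≤ R) (hG : G.Nonempty) (k : ℕ) (y : Q) :
    -R ≤ lipschitzMinorant F G k y := by
  have : Nonempty G := hG.to_subtype
  refine le_ciInf fun z => ?_
  have h1 := (abs_le.1 (hF z z.2)).1
  have h2 : 0 ≤ (k : ℝ) * dist y z := by positivity
  linarith

lemma continuous_lipschitzMinorant (hF : ∀ z ∈ G, |F z| ≤ R) (hG : G.Nonempty) (k : ℕ) :
    Continuous (lipschitzMinorant F G k) := by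
  have : Nonempty G := hG.to_subtype
  refine (LipschitzWith.of_le_add_mul' (k : ℝ) fun x y => ?_).continuous
  rw [← sub_le_iff_le_add]
  refine le_ciInf fun z => ?_
  have h1 := lipschitzMinorant_le hF k x z.2
  have h2 := mul_le_mul_of_nonneg_left (dist_triangle x y z) (Nat.cast_nonneg (α := ℝ) k)
  linarith

lemma lipschitzMinorant_mono (hF : ∀ z ∈ G, |F z| ≤ R) (hG : G.Nonempty) (y : Q) :
    Monotone fun k => lipschitzMinorant F G k y := by
  have : Nonempty G := hG.to_subtype
  intro k l hkl
  refine le_ciInf fun z => (lipschitzMinorant_le hF k y z.2).trans ?_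
  have : (k : ℝ) ≤ l := Nat.cast_le.2 hkl
  have := mul_le_mul_of_nonneg_right this (dist_nonneg (x := y) (y := (z : Q)))
  linarith

open MeasureTheory

variable [CompactSpace Q] [MeasurableSpace Q] [BorelSpace Q]

/-- If the integral of `F` drops by `β` along a weakly convergent family of probability measures,
then `F` itself drops by almost `β` along some convergent family of points of a set of full
measure. -/
lemma exists_forall_dist_lt_drop {ι : Type*} {l : Filter ι} [l.NeBot] {μ : ι → ProbabilityMeasure Q}
    {ν : ProbabilityMeasure Q} (hμ : Tendsto μ l (𝓝 ν)) (hFm : Measurable F)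
    (hF : ∀ z ∈ G, |F z| ≤ R) (hGμ : ∀ i, ∀ᵐ y ∂(μ i : Measure Q), y ∈ G)
    (hGν : ∀ᵐ y ∂(ν : Measure Q), y ∈ G) {β β' : ℝ} (hβ : β' < β)
    (hdrop : ∀ i, (∫ y, F y ∂(μ i : Measure Q)) + β ≤ ∫ y, F y ∂(ν : Measure Q)) :
    ∃ y ∈ G, ∀ δ > 0, ∃ z ∈ G, dist y z < δ ∧ F z + β' < F y := by
  have hG : G.Nonempty := hGν.exists
  have hint : ∀ (ρ : ProbabilityMeasure Q), (∀ᵐ y ∂(ρ : Measure Q), y ∈ G) →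
      Integrable F (ρ : Measure Q) := fun ρ hρ =>
    Integrable.of_bound hFm.aestronglyMeasurable R (hρ.mono fun y hy => hF y hy)
  -- Weak convergence tests only continuous functions, so the drop of F is carried to ν by its
  -- continuous minorants.
  set ψ : ℕ → C(Q, ℝ) := fun k => ⟨lipschitzMinorant F G k, continuous_lipschitzMinorant hF hG k⟩
  have hψF : ∀ k, ∀ y ∈ G, ψ k y ≤ F y := fun k y hy => by
    have h := lipschitzMinorant_le hF k y hy
    rwa [dist_self, mul_zero, add_zero] at h
  have hψν : ∀ k, (∫ y, ψ k y ∂(ν : Measure Q)) + β ≤ ∫ y, F y ∂(ν : Measure Q) := by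
    intro k
    refine le_of_tendsto ((tendsto_integral_continuousMap hμ (ψ k)).add_const β)
      (Eventually.of_forall fun i => le_trans ?_ (hdrop i))
    have := integral_mono_ae (integrable_continuousMap (ψ k) _) (hint _ (hGμ i))
      ((hGμ i).mono fun y hy => hψF k y hy)
    linarith
  -- Otherwise, by monotonicity in k, the positive parts of `F - ψ k - β'` vanish eventually at each
  -- point of G. Their integrals then tend to 0, yet are at least `β - β'`.
  obtain ⟨y, hyG, hy⟩ : ∃ y ∈ G, ∀ k, β' < F y - ψ k y := by
    by_contra! hcon
    have hlim : Tendsto (fun k => ∫ y, max (F y - ψ k y - β') 0 ∂(ν : Measure Q)) atTop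
        (𝓝 (∫ _, (0 : ℝ) ∂(ν : Measure Q))) := by
      refine tendsto_integral_of_dominated_convergence (fun _ => 2 * R + |β'|) (fun k => ?_)
        (integrable_const _) (fun k => ?_) ?_
      · exact (((hFm.sub (ψ k).continuous.measurable).sub_const β').max
          measurable_const).aestronglyMeasurable
      · filter_upwards [hGν] with y hy
        rw [Real.norm_eq_abs, abs_of_nonneg (le_max_right _ _)]
        have h1 := (abs_le.1 (hF y hy)).2
        have h2 : -R ≤ ψ k y := neg_le_lipschitzMinorant hF hG k y
        have h3 := neg_abs_le β'
        exact max_le (by linarith) (by linarith [abs_nonneg (F y), hF y hy, abs_nonneg β'])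
      · filter_upwards [hGν] with y hy
        obtain ⟨k, hk⟩ := hcon y hy
        refine tendsto_const_nhds.congr' ?_
        filter_upwards [eventually_ge_atTop k] with l hl
        have : ψ k y ≤ ψ l y := lipschitzMinorant_mono hF hG y hl
        rw [max_eq_right (by linarith)]
    rw [integral_zero] at hlim
    have hle : β - β' ≤ 0 := by
      refine ge_of_tendsto' hlim fun k => ?_
      have hi : Integrable (fun y => F y - ψ k y - β') (ν : Measure Q) :=
        ((hint ν hGν).sub (integrable_continuousMap (ψ k) _)).sub (integrable_const β')
      have h1 : ∫ y, (F y - ψ k y - β') ∂(ν : Measure Q) =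
          (∫ y, F y ∂(ν : Measure Q)) - (∫ y, ψ k y ∂(ν : Measure Q)) - β' := by
        have h3 : Integrable (fun y => F y - ψ k y) (ν : Measure Q) :=
          (hint ν hGν).sub (integrable_continuousMap (ψ k) _)
        rw [integral_sub h3 (integrable_const β'), integral_sub (hint ν hGν)
          (integrable_continuousMap (ψ k) _)]
        simp
      have h2 : ∫ y, (F y - ψ k y - β') ∂(ν : Measure Q) ≤
          ∫ y, max (F y - ψ k y - β') 0 ∂(ν : Measure Q) :=
        integral_mono hi hi.pos_part fun y => le_max_left _ _
      linarith [hψν k]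
    linarith
  refine ⟨y, hyG, fun δ hδ => ?_⟩
  -- For such k the penalty `k * dist y z` at distance δ or more exceeds any possible drop of F.
  obtain ⟨k, hk⟩ := exists_nat_gt ((2 * R + |β'|) / δ)
  rw [div_lt_iff₀ hδ] at hk
  have : Nonempty G := hG.to_subtype
  obtain ⟨⟨z, hz⟩, hlt⟩ := exists_lt_of_ciInf_lt
    (show (⨅ z : G, (F z + k * dist y z)) < F y - β' by
      have := hy k
      change β' < F y - (⨅ z : G, (F z + k * dist y z)) at this
      linarith)
  change F z + k * dist y z < F y - β' at hlt
  have h0 : 0 ≤ (k : ℝ) * dist y z := by positivity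
  refine ⟨z, hz, ?_, by linarith⟩
  by_contra! hge
  have h1 := mul_le_mul_of_nonneg_left hge (Nat.cast_nonneg (α := ℝ) k)
  have h2 := (abs_le.1 (hF y hyG)).2
  have h3 := (abs_le.1 (hF z hz)).1
  linarith [neg_abs_le β']

/-- Continuous functions whose integrals are separated along weakly convergent probability
measures have convex combinations that are separated along points of a set of full measure. -/
lemma exists_separated_points {l : Filter ℕ} [l.NeBot]
    {μ : ℕ → ProbabilityMeasure Q} {ν : ProbabilityMeasure Q} (hμ : Tendsto μ l (𝓝 ν))
    {π : ℕ → C(Q, ℝ)} (hπ : ∀ m, ‖π m‖ ≤ R) {β β' : ℝ} (hβ : β' < β)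
    (hsep : ∀ i m, i < m →
      (∫ y, π m y ∂(μ i : Measure Q)) + β ≤ ∫ y, π m y ∂(ν : Measure Q))
    {T : Set Q} (hTμ : ∀ i, ∀ᵐ y ∂(μ i : Measure Q), y ∈ T) (hTν : ∀ᵐ y ∂(ν : Measure Q), y ∈ T) :
    ∃ (y : ℕ → Q) (g : ℕ → C(Q, ℝ)), (∀ i, y i ∈ T) ∧ (∀ m, g m ∈ convexHull ℝ (Set.range π)) ∧
      ∀ i m j, i < m → m ≤ j → β' ≤ g m (y j) - g m (y i) := by
  classical
  obtain ⟨g, F, hg, hFm, hlim⟩ := exists_ae_tendsto_convexHull hπ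
    (fun o : Option ℕ => ((o.elim ν μ : ProbabilityMeasure Q) : Measure Q))
  have hlimν : ∀ᵐ y ∂(ν : Measure Q), Tendsto (fun k => g k y) atTop (𝓝 (F y)) := hlim none
  have hlimμ : ∀ i, ∀ᵐ y ∂(μ i : Measure Q), Tendsto (fun k => g k y) atTop (𝓝 (F y)) :=
    fun i => hlim (some i)
  have hgR : ∀ k y, ‖g k y‖ ≤ R := fun k y =>
    ((g k).norm_coe_le_norm y).trans (norm_le_of_mem_convexHull_image hπ (hg k))
  set G : Set Q := {y | y ∈ T ∧ Tendsto (fun k => g k y) atTop (𝓝 (F y))} with hG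
  have hF : ∀ y ∈ G, |F y| ≤ R := fun y hy =>
    le_of_tendsto hy.2.norm (Eventually.of_forall fun k => hgR k y)
  have hint : ∀ ρ : ProbabilityMeasure Q,
      (∀ᵐ y ∂(ρ : Measure Q), Tendsto (fun k => g k y) atTop (𝓝 (F y))) →
      Tendsto (fun k => ∫ y, g k y ∂(ρ : Measure Q)) atTop (𝓝 (∫ y, F y ∂(ρ : Measure Q))) :=
    fun ρ hρ => tendsto_integral_of_dominated_convergence (fun _ => R)
      (fun k => (g k).continuous.aestronglyMeasurable) (integrable_const _)
      (fun k => Eventually.of_forall fun y => hgR k y) hρ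
  have hdrop : ∀ i, (∫ y, F y ∂(μ i : Measure Q)) + β ≤ ∫ y, F y ∂(ν : Measure Q) := fun i => by
    refine le_of_tendsto_of_tendsto ((hint _ (hlimμ i)).add_const β) (hint _ hlimν) ?_
    filter_upwards [eventually_gt_atTop i] with k hk
    exact le_integral_sub_of_mem_convexHull (fun m hm => hsep i m (hk.trans_le hm)) (hg k)
  obtain ⟨y, hyG, hy⟩ := exists_forall_dist_lt_drop hμ hFm hF
    (fun i => (hTμ i).and (hlimμ i)) (hTν.and hlimν) (show (β + β') / 2 < β by linarith) hdrop
  have hη : 0 < (β - β') / 8 := by linarith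
  -- Each new block is close to F at y and at all old points; each new point is so close to y that
  -- all blocks so far barely change. Three errors of `(β - β') / 8` fit into the margin `(β - β') /
  -- 2`.
  obtain ⟨p, hp, hr⟩ := exists_seq_of_forall_finset_exists
    (fun p : Q × C(Q, ℝ) => (p.1 ∈ G ∧ F p.1 + (β + β') / 2 < F y) ∧
      p.2 ∈ convexHull ℝ (Set.range π) ∧ |p.2 y - F y| < (β - β') / 8 ∧
      |p.2 p.1 - p.2 y| < (β - β') / 8)
    (fun p q => |q.2 p.1 - F p.1| < (β - β') / 8 ∧ |p.2 q.1 - p.2 y| < (β - β') / 8) (by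
      intro s hs
      have h1 : ∀ᶠ k in atTop, ∀ p ∈ s, |g k p.1 - F p.1| < (β - β') / 8 :=
        (Finset.eventually_all s).2 fun p hp =>
          Metric.tendsto_nhds.1 (hs p hp).1.1.2 _ hη
      obtain ⟨k, hk1, hk2⟩ := (h1.and (Metric.tendsto_nhds.1 hyG.2 _ hη)).exists
      have h2 : ∀ᶠ z in 𝓝 y, ∀ h ∈ insert (g k) (s.image Prod.snd),
          |h z - h y| < (β - β') / 8 :=
        (Finset.eventually_all _).2 fun h _ =>
          Metric.tendsto_nhds.1 (h.continuous.tendsto y) _ hη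
      obtain ⟨δ, hδ, hball⟩ := Metric.eventually_nhds_iff.1 h2
      obtain ⟨z, hzG, hzδ, hzF⟩ := hy δ hδ
      rw [dist_comm] at hzδ
      refine ⟨(z, g k), ⟨⟨hzG, hzF⟩, convexHull_mono (image_subset_range _ _) (hg k), hk2,
        hball hzδ _ (Finset.mem_insert_self _ _)⟩, fun q hq => ⟨hk1 q hq, hball hzδ _
          (Finset.mem_insert_of_mem (Finset.mem_image_of_mem _ hq))⟩⟩)
  refine ⟨fun i => (p i).1, fun m => (p m).2, fun i => (hp i).1.1.1, fun m => (hp m).2.1, ?_⟩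
  intro i m j him hmj
  have h1 := (abs_lt.1 (hr i m him).1).2
  have h2 := (hp i).1.2
  have h3 := (abs_lt.1 (hp m).2.2.1).1
  have h4 : |(p m).2 (p j).1 - (p m).2 y| < (β - β') / 8 := by
    rcases hmj.eq_or_lt with rfl | hlt
    · exact (hp m).2.2.2
    · exact (hr m j hlt).2
  have h5 := (abs_lt.1 h4).1
  linarith

end Envelope

/-! ### Passing from the convex hull to the set. -/

section ConvexHull

open MeasureTheory

/-- The coordinate functions on the cube `[-R, R]^ℕ`. -/
def cubeCoord (R : ℝ) (m : ℕ) : C(ℕ → Icc (-R) R, ℝ) :=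
  ⟨fun y => (y m : ℝ), continuous_subtype_val.comp (continuous_apply m)⟩

lemma norm_cubeCoord_le {R : ℝ} (hR : 0 ≤ R) (m : ℕ) : ‖cubeCoord R m‖ ≤ R :=
  (ContinuousMap.norm_le _ hR).2 fun y => abs_le.2 (y m).2

variable {X : Type*} [NormedAddCommGroup X] [NormedSpace ℝ X]

/-- The map to the cube `[-R, R]^ℕ` with coordinates the functionals `f m`, truncated. -/
noncomputable def cubeMap {R : ℝ} (hR : -R ≤ R) (f : ℕ → StrongDual ℝ X) (a : X) : ℕ → Icc (-R) R :=
  fun m => projIcc (-R) R hR (f m a)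

variable {A : Set X} {R : ℝ} (hR : -R ≤ R) (hA : ∀ a ∈ A, ‖a‖ ≤ R) {f : ℕ → StrongDual ℝ X}
  (hf : ∀ m, ‖f m‖ ≤ 1)

include hA hf in
lemma cubeCoord_cubeMap {a : X} (ha : a ∈ A) (m : ℕ) :
    cubeCoord R m (cubeMap hR f a) = f m a := by
  have h : |f m a| ≤ R :=
    ((f m).le_of_opNorm_le (hf m) a).trans ((one_mul _).trans_le (hA a ha))
  exact congrArg Subtype.val (projIcc_of_mem hR (abs_le.1 h))

include hA hf in
-- Dirac measures serve the points of A, and both conditions survive mixtures. The support condition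
-- is phrased with null open sets because that form passes to weak limits.
lemma exists_measure_of_mem_convexHull {u : X} (hu : u ∈ convexHull ℝ A) :
    ∃ μ : ProbabilityMeasure (ℕ → Icc (-R) R),
      (∀ O : Set (ℕ → Icc (-R) R), IsOpen O → (∀ a ∈ A, cubeMap hR f a ∉ O) →
        (μ : Measure (ℕ → Icc (-R) R)) O = 0) ∧
      ∀ m, ∫ y, cubeCoord R m y ∂(μ : Measure (ℕ → Icc (-R) R)) = f m u := by
  set C : Set X := {u | ∃ μ : ProbabilityMeasure (ℕ → Icc (-R) R),
      (∀ O : Set (ℕ → Icc (-R) R), IsOpen O → (∀ a ∈ A, cubeMap hR f a ∉ O) →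
        (μ : Measure (ℕ → Icc (-R) R)) O = 0) ∧
      ∀ m, ∫ y, cubeCoord R m y ∂(μ : Measure (ℕ → Icc (-R) R)) = f m u} with hC
  have hAC : A ⊆ C := by
    intro a ha
    refine ⟨⟨Measure.dirac (cubeMap hR f a), inferInstance⟩, fun O hO hAO => ?_, fun m => ?_⟩
    · change Measure.dirac (cubeMap hR f a) O = 0
      rw [Measure.dirac_apply' _ hO.measurableSet, indicator_of_notMem (hAO a ha)]
    · change ∫ y, cubeCoord R m y ∂(Measure.dirac (cubeMap hR f a)) = f m a
      rw [integral_dirac, cubeCoord_cubeMap hR hA hf ha]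
  have hconv : Convex ℝ C := by
    rintro u ⟨μ, hμ0, hμ⟩ v ⟨ν, hν0, hν⟩ a b ha hb hab
    have hprob : IsProbabilityMeasure (ENNReal.ofReal a • (μ : Measure (ℕ → Icc (-R) R)) +
        ENNReal.ofReal b • (ν : Measure (ℕ → Icc (-R) R))) := by
      constructor
      simp only [Measure.coe_add, Measure.coe_smul, Pi.add_apply, Pi.smul_apply, measure_univ,
        smul_eq_mul, mul_one]
      rw [← ENNReal.ofReal_add ha hb, hab, ENNReal.ofReal_one]
    refine ⟨⟨_, hprob⟩, fun O hO hAO => ?_, fun m => ?_⟩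
    · change (ENNReal.ofReal a • (μ : Measure (ℕ → Icc (-R) R)) +
        ENNReal.ofReal b • (ν : Measure (ℕ → Icc (-R) R))) O = 0
      simp [hμ0 O hO hAO, hν0 O hO hAO]
    · change ∫ y, cubeCoord R m y ∂(ENNReal.ofReal a • (μ : Measure (ℕ → Icc (-R) R)) +
        ENNReal.ofReal b • (ν : Measure (ℕ → Icc (-R) R))) = _
      rw [integral_add_measure
        ((integrable_continuousMap _ _).smul_measure ENNReal.ofReal_ne_top)
        ((integrable_continuousMap _ _).smul_measure ENNReal.ofReal_ne_top),
        integral_smul_measure, integral_smul_measure, hμ, hν, ENNReal.toReal_ofReal ha,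
        ENNReal.toReal_ofReal hb, map_add, map_smul, map_smul]
  exact convexHull_min hAC hconv hu

include hA hf in
lemma exists_functional_of_mem_convexHull {g : C(ℕ → Icc (-R) R, ℝ)}
    (hg : g ∈ convexHull ℝ (Set.range (cubeCoord R))) :
    ∃ h : StrongDual ℝ X, ‖h‖ ≤ 1 ∧ ∀ a ∈ A, h a = g (cubeMap hR f a) := by
  have hconv : Convex ℝ {g : C(ℕ → Icc (-R) R, ℝ) |
      ∃ h : StrongDual ℝ X, ‖h‖ ≤ 1 ∧ ∀ a ∈ A, h a = g (cubeMap hR f a)} := by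
    rintro g ⟨h, hh, hga⟩ g' ⟨h', hh', hga'⟩ a b ha hb hab
    refine ⟨a • h + b • h', ?_, fun x hx => ?_⟩
    · have := convex_closedBall (0 : StrongDual ℝ X) 1 (mem_closedBall_zero_iff.2 hh)
        (mem_closedBall_zero_iff.2 hh') ha hb hab
      exact mem_closedBall_zero_iff.1 this
    · change a * h x + b * h' x = a * g _ + b * g' _
      rw [hga x hx, hga' x hx]
  refine convexHull_min ?_ hconv hg
  rintro _ ⟨m, rfl⟩
  exact ⟨f m, hf m, fun a ha => (cubeCoord_cubeMap hR hA hf ha m).symm⟩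

lemma exists_ultralimit_measure {Q : Type*} [TopologicalSpace Q] [CompactSpace Q] [T2Space Q]
    [MeasurableSpace Q] [BorelSpace Q] (U : Ultrafilter ℕ) (μ : ℕ → ProbabilityMeasure Q) :
    ∃ ν, Tendsto μ (U : Filter ℕ) (𝓝 ν) := by
  obtain ⟨ν, -, hν⟩ := isCompact_univ.ultrafilter_le_nhds' (U.map μ) univ_mem
  exact ⟨ν, hν⟩

lemma measure_eq_zero_of_tendsto {Q : Type*} [TopologicalSpace Q] [HasOuterApproxClosed Q]
    [MeasurableSpace Q] [OpensMeasurableSpace Q] {ι : Type*} {l : Filter ι} [l.NeBot]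
    {μ : ι → ProbabilityMeasure Q} {ν : ProbabilityMeasure Q} (h : Tendsto μ l (𝓝 ν)) {O : Set Q}
    (hO : IsOpen O) (h0 : ∀ᶠ i in l, (μ i : Measure Q) O = 0) : (ν : Measure Q) O = 0 := by
  have h1 := ProbabilityMeasure.le_liminf_measure_open_of_tendsto h hO
  have h2 : l.liminf (fun i => (μ i : Measure Q) O) = 0 := by
    rw [liminf_congr h0]
    exact liminf_const 0
  exact le_antisymm (h1.trans h2.le) zero_le

variable {U : Ultrafilter ℕ}

/-- The functionals vary with n, but the cube does not, so the representing measures have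
ultralimits on it. These live on the set T of points approached by images of A for U-many n, so
separated points of T can be pulled back to A at one common n. -/
lemma HasSeparatedSequences.of_convexHull (hU : IsFree U) (hAb : Bornology.IsBounded A) {β β' : ℝ}
    (h : HasSeparatedSequences (convexHull ℝ A) β) (hβ : β' < β) : HasSeparatedSequences A β' := by
  classical
  obtain ⟨R, hR0, hA⟩ := hAb.exists_pos_norm_le
  have hR : -R ≤ R := by linarith
  choose x f hx hf hsep using h
  have hmem : ∀ i n, (if i < n then x n i else x 1 0) ∈ convexHull ℝ A := fun i n => by
    split_ifs with h
    exacts [hx n i h, hx 1 0 one_pos]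
  have hμ' := fun j n => exists_measure_of_mem_convexHull hR hA (hf n) (hmem j n)
  choose μ' hμ'0 hμ' using hμ'
  choose μ hμ using fun j => exists_ultralimit_measure U (μ' j)
  obtain ⟨ν, hν⟩ := exists_ultralimit_measure U μ
  let _ : MetricSpace (ℕ → Icc (-R) R) := TopologicalSpace.metrizableSpaceMetric _
  set T : Set (ℕ → Icc (-R) R) := {y | ∀ O, IsOpen O → y ∈ O →
    ∀ᶠ n in (U : Filter ℕ), ∃ a ∈ A, cubeMap hR (f n) a ∈ O} with hT
  have hTopen : ∀ y ∈ Tᶜ, ∃ O, IsOpen O ∧ y ∈ O ∧ ∀ j, (μ j : Measure (ℕ → Icc (-R) R)) O = 0 := by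
    intro y hy
    simp only [hT, mem_compl_iff, mem_ofPred_eq, not_forall] at hy
    obtain ⟨O, hO, hyO, hn⟩ := hy
    rw [← Ultrafilter.eventually_not] at hn
    refine ⟨O, hO, hyO, fun j => measure_eq_zero_of_tendsto (hμ j) hO (hn.mono fun n hn => ?_)⟩
    exact hμ'0 j n O hO fun a ha haO => hn ⟨a, ha, haO⟩
  have hTμ : ∀ j, ∀ᵐ y ∂(μ j : Measure (ℕ → Icc (-R) R)), y ∈ T := fun j => by
    refine measure_null_of_locally_null _ fun y hy => ?_
    obtain ⟨O, hO, hyO, h0⟩ := hTopen y hy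
    exact ⟨O, mem_nhdsWithin_of_mem_nhds (hO.mem_nhds hyO), h0 j⟩
  have hTν : ∀ᵐ y ∂(ν : Measure (ℕ → Icc (-R) R)), y ∈ T := by
    refine measure_null_of_locally_null _ fun y hy => ?_
    obtain ⟨O, hO, hyO, h0⟩ := hTopen y hy
    exact ⟨O, mem_nhdsWithin_of_mem_nhds (hO.mem_nhds hyO),
      measure_eq_zero_of_tendsto hν hO (Eventually.of_forall h0)⟩
  have hsepμ : ∀ i m j, i < m → m ≤ j →
      (∫ y, cubeCoord R m y ∂(μ i : Measure (ℕ → Icc (-R) R))) + β ≤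
        ∫ y, cubeCoord R m y ∂(μ j : Measure (ℕ → Icc (-R) R)) := by
    intro i m j him hmj
    refine le_of_tendsto_of_tendsto ((tendsto_integral_continuousMap (hμ i) _).add_const β)
      (tendsto_integral_continuousMap (hμ j) _) ?_
    filter_upwards [eventually_gt_of_isFree hU j] with n hn
    rw [hμ', hμ', if_pos hn, if_pos ((him.trans_le hmj).trans hn)]
    linarith [hsep n i m j him hmj hn]
  have hsepν : ∀ i m, i < m →
      (∫ y, cubeCoord R m y ∂(μ i : Measure (ℕ → Icc (-R) R))) + β ≤
        ∫ y, cubeCoord R m y ∂(ν : Measure (ℕ → Icc (-R) R)) := by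
    intro i m him
    refine ge_of_tendsto (tendsto_integral_continuousMap hν _) ?_
    filter_upwards [eventually_gt_of_isFree hU m] with j hj
    exact hsepμ i m j him hj.le
  obtain ⟨y, g, hyT, hg, hyg⟩ := exists_separated_points hν (norm_cubeCoord_le hR0.le)
    (show (β + β') / 2 < β by linarith) hsepν hTμ hTν
  intro N
  -- Half of the loss went into the separated points; the other half pays for two approximations by
  -- images of points of A.
  set η := (β - β') / 4 with hη
  have hη0 : 0 < η := by rw [hη]; linarith
  have hev : ∀ᶠ n in (U : Filter ℕ), ∀ i ∈ Finset.range N, ∃ a ∈ A, ∀ m ∈ Finset.range N,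
      |g m (cubeMap hR (f n) a) - g m (y i)| < η := by
    refine (Finset.eventually_all _).2 fun i _ => ?_
    refine (hyT i {w | ∀ m ∈ Finset.range N, |g m w - g m (y i)| < η} ?_ ?_)
    · simp only [ofPred_forall]
      exact isOpen_biInter_finset fun m _ =>
        isOpen_lt (((g m).continuous.sub continuous_const).abs) continuous_const
    · intro m _
      simpa using hη0
  obtain ⟨n, hn⟩ := hev.exists
  have hn' : ∀ i, ∃ a, i < N → a ∈ A ∧ ∀ m < N, |g m (cubeMap hR (f n) a) - g m (y i)| < η := by
    intro i
    by_cases hi : i < N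
    · obtain ⟨a, ha, hga⟩ := hn i (Finset.mem_range.2 hi)
      exact ⟨a, fun _ => ⟨ha, fun m hm => hga m (Finset.mem_range.2 hm)⟩⟩
    · exact ⟨0, fun h => absurd h hi⟩
  choose a ha using hn'
  choose φ hφ1 hφ using fun m => exists_functional_of_mem_convexHull hR hA (hf n) (hg m)
  refine ⟨a, φ, fun i hi => (ha i hi).1, hφ1, fun i m j him hmj hj => ?_⟩
  have hm : m < N := hmj.trans_lt hj
  have hi : i < N := him.trans hm
  rw [hφ m _ (ha j hj).1, hφ m _ (ha i hi).1]
  have h1 := (abs_lt.1 ((ha j hj).2 m hm)).1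
  have h2 := (abs_lt.1 ((ha i hi).2 m hm)).2
  have h3 := hyg i m j him hmj
  linarith

end ConvexHull

/-! ### The properties of Γ. -/

section SuperWeakNoncompactness

variable {X : Type*} [NormedAddCommGroup X] [NormedSpace ℝ X] {U V : Ultrafilter ℕ}

lemma Gam_nonneg (U : Ultrafilter ℕ) (A : Set X) : 0 ≤ Gam U A := gammaMeasure_nonneg _

lemma Gam_closure (hU : IsFree U) (A : Set X) : Gam U (closure A) = Gam U A := by
  rw [Gam, setUltrapower_closure U hU, Gam]

lemma Gam_union {A B : Set X} (hA : Bornology.IsBounded A) (hB : Bornology.IsBounded B) :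
    Gam U (A ∪ B) = max (Gam U A) (Gam U B) := by
  rw [Gam, setUltrapower_union, gammaMeasure_union (isBounded_setUltrapower U hA)
    (isBounded_setUltrapower U hB), Gam, Gam]

lemma Gam_smul {A : Set X} (hA : Bornology.IsBounded A) (c : ℝ) :
    Gam U (c • A) = |c| * Gam U A := by
  rw [Gam, setUltrapower_smul U hA, gammaMeasure_smul (isBounded_setUltrapower U hA), Gam]

lemma Gam_add_le {A B : Set X} (hA : Bornology.IsBounded A) (hB : Bornology.IsBounded B) :
    Gam U (A + B) ≤ Gam U A + Gam U B :=
  (gammaMeasure_mono ((isBounded_setUltrapower U hA).add (isBounded_setUltrapower U hB))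
    (setUltrapower_add_subset U hA hB)).trans
    (gammaMeasure_add_le (isBounded_setUltrapower U hA) (isBounded_setUltrapower U hB))

lemma Gam_convexHull_le (hU : IsFree U) {A : Set X} (hA : Bornology.IsBounded A) :
    Gam U (convexHull ℝ A) ≤ 2 * Gam U A := by
  refine le_of_forall_lt_imp_le_of_dense fun s hs => ?_
  rcases lt_or_ge s 0 with h0 | h0
  · linarith [Gam_nonneg U A]
  obtain ⟨t, hst, ht⟩ := exists_between hs
  obtain ⟨r, hsr, hrt⟩ := exists_between hst
  exact ((hasSeparatedSequences_of_lt_Gam U (h0.trans_lt hst) ht hrt).of_convexHull hU hA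
    hsr).le_two_mul_Gam hU hA

/-- Separated sequences found through U are fed back through V; this lets `IsRelSWC`, which allows
any free V, be tested on U alone. -/
lemma Gam_le_two_mul_Gam (hV : IsFree V) {A : Set X} (hA : Bornology.IsBounded A) :
    Gam U A ≤ 2 * Gam V A := by
  refine le_of_forall_lt_imp_le_of_dense fun s hs => ?_
  rcases lt_or_ge s 0 with h0 | h0
  · linarith [Gam_nonneg V A]
  obtain ⟨t, hst, ht⟩ := exists_between hs
  exact (hasSeparatedSequences_of_lt_Gam U (h0.trans_lt hst) ht hst).le_two_mul_Gam hV hA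

lemma Gam_eq_zero_iff [CompleteSpace X] {A : Set X} (hA : Bornology.IsBounded A) :
    Gam U A = 0 ↔ IsRelWeaklyCompact (setUltrapower U A) :=
  gammaMeasure_eq_zero_iff (isBounded_setUltrapower U hA)

lemma Gam_eq_zero_iff_isRelSWC [CompleteSpace X] (hU : IsFree U) {A : Set X}
    (hA : Bornology.IsBounded A) : Gam U A = 0 ↔ IsRelSWC A := by
  constructor
  · exact fun h => ⟨U, hU, (Gam_eq_zero_iff hA).1 h⟩
  · rintro ⟨V, hV, h⟩
    have h0 : Gam V A = 0 := (Gam_eq_zero_iff hA).2 h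
    refine le_antisymm ?_ (Gam_nonneg U A)
    simpa [h0] using Gam_le_two_mul_Gam (U := U) hV hA

lemma subset_weakClosure (A : Set X) : A ⊆ weakClosure A :=
  fun a ha => subset_closure (X := WeakSpace ℝ X) ⟨a, ha, rfl⟩

lemma isWeaklyClosed_weakClosure (A : Set X) : IsWeaklyClosed (weakClosure A) := by
  rw [IsWeaklyClosed, weakClosure, Set.image_preimage_eq _ (toWeakSpace ℝ X).surjective]
  exact isClosed_closure

/-- Mazur: convex sets have the same norm and weak closures. -/
lemma weakClosure_subset_closure_convexHull (A : Set X) :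
    weakClosure A ⊆ closure (convexHull ℝ A) := by
  intro a ha
  have h := closure_mono (X := WeakSpace ℝ X)
    (image_mono (f := toWeakSpace ℝ X) (subset_convexHull ℝ A)) ha
  rw [← (convex_convexHull ℝ A).toWeakSpace_closure (𝕜 := ℝ)] at h
  obtain ⟨b, hb, hba⟩ := h
  rwa [← (toWeakSpace ℝ X).injective hba]

lemma isBounded_weakClosure {A : Set X} (hA : Bornology.IsBounded A) :
    Bornology.IsBounded (weakClosure A) :=
  ((isBounded_convexHull.2 hA).closure).subset (weakClosure_subset_closure_convexHull A)

lemma Gam_weakClosure_le (hU : IsFree U) {A : Set X} (hA : Bornology.IsBounded A) :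
    Gam U (weakClosure A) ≤ 2 * Gam U A := by
  refine (Gam_mono U (isBounded_convexHull.2 hA).closure
    (weakClosure_subset_closure_convexHull A)).trans ?_
  rw [Gam_closure hU]
  exact Gam_convexHull_le hU hA

lemma Gam_eq_zero_iff_isSWC_weakClosure [CompleteSpace X] (hU : IsFree U) {A : Set X}
    (hA : Bornology.IsBounded A) : Gam U A = 0 ↔ IsSWC (weakClosure A) := by
  rw [IsSWC, and_iff_left (isWeaklyClosed_weakClosure A),
    ← Gam_eq_zero_iff_isRelSWC hU (isBounded_weakClosure hA)]
  constructor
  · intro h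
    refine le_antisymm ?_ (Gam_nonneg U _)
    simpa [h] using Gam_weakClosure_le hU hA
  · intro h
    exact le_antisymm ((Gam_mono U (isBounded_weakClosure hA) (subset_weakClosure A)).trans_eq h)
      (Gam_nonneg U A)

end SuperWeakNoncompactness

end SuperWeak

theorem proposition3p5 {X : Type*} [NormedAddCommGroup X] [NormedSpace ℝ X] [CompleteSpace X]
    (U : Ultrafilter ℕ) (hU : SuperWeak.IsFree U) :
    (∀ A : Set X, Bornology.IsBounded A → 0 ≤ SuperWeak.Gam U A) ∧
    (∀ A : Set X, Bornology.IsBounded A →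
      SuperWeak.Gam U (closure A) = SuperWeak.Gam U A) ∧
    (∀ A : Set X, Bornology.IsBounded A →
      (SuperWeak.Gam U A = 0 ↔ SuperWeak.IsRelSWC A) ∧
      (SuperWeak.Gam U A = 0 ↔ SuperWeak.IsSWC (SuperWeak.weakClosure A))) ∧
    (∀ A B : Set X, Bornology.IsBounded A → Bornology.IsBounded B →
      SuperWeak.Gam U (A ∪ B) = max (SuperWeak.Gam U A) (SuperWeak.Gam U B)) ∧
    (∀ (c : ℝ) (A : Set X), Bornology.IsBounded A →
      SuperWeak.Gam U (c • A) = |c| * SuperWeak.Gam U A) ∧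
    (∀ A B : Set X, Bornology.IsBounded A → Bornology.IsBounded B →
      SuperWeak.Gam U (A + B) ≤ SuperWeak.Gam U A + SuperWeak.Gam U B) ∧
    (∀ A : Set X, Bornology.IsBounded A →
      SuperWeak.Gam U (convexHull ℝ A) ≤ 4 * SuperWeak.Gam U A) := by
  refine ⟨fun A _ => SuperWeak.Gam_nonneg U A, fun A _ => SuperWeak.Gam_closure hU A,
    fun A hA => ⟨SuperWeak.Gam_eq_zero_iff_isRelSWC hU hA,
      SuperWeak.Gam_eq_zero_iff_isSWC_weakClosure hU hA⟩,
    fun A B hA hB => SuperWeak.Gam_union hA hB, fun c A hA => SuperWeak.Gam_smul hA c,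
    fun A B hA hB => SuperWeak.Gam_add_le hA hB, fun A hA => ?_⟩
  linarith [SuperWeak.Gam_convexHull_le hU hA, SuperWeak.Gam_nonneg U A]
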